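/- Let $\Bbbk$ be an algebraically closed field of characteristic zero, let $n$ be an odd positive integer, and let $H$ be a Hopf algebra over $\Bbbk$ of dimension $2n$, with comultiplication $\Delta(h)=\sum h_1\otimes h_2$ and antipode $S$. A Hopf subalgebra of $H$ is a unital subalgebra $K$ with $\Delta(K)\subseteq K\otimes K$ and $S(K)\subseteq K$; it is called normal if $\sum h_1 a S(h_2)\in K$ and $\sum S(h_1)\,a\,h_2\in K$ for all $h\in H$ and $a\in K$. (a) If $A$ is a Hopf algebra over $\Bbbk$ of dimension $n$ and $\pi:H\to A$ is a surjective homomorphism of Hopf algebras, then the set of coinvariants $$H^{\mathrm{co}\,\pi}=\{h\in H \mid (\mathrm{id}_H\otimes\pi)\Delta(h)=h\otimes 1_A\}$$ is a normal Hopf subalgebra of $H$, and it is isomorphic as a Hopf algebra to the group algebra $\Bbbk[\mathbb{Z}_2]$ of the cyclic group of order $2$. (b) Every Hopf subalgebra of $H$ of dimension $n$ is a normal Hopf subalgebra of $H$. -/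

import Mathlib

open scoped TensorProduct

noncomputable section

/-- A Hopf subalgebra of a Hopf algebra `H` over `k`: a unital subalgebra `A` with
`Δ(A) ⊆ A ⊗ A` (i.e. the image of `A ⊗ A` in `H ⊗ H`) and `S(A) ⊆ A`. -/
structure HopfSubalgebra (k : Type*) (H : Type*) [Field k] [Ring H] [HopfAlgebra k H]
    extends Subalgebra k H where
  comul_mem : ∀ a ∈ toSubalgebra, Coalgebra.comul (R := k) a ∈
    (Algebra.TensorProduct.map toSubalgebra.val toSubalgebra.val).range
  antipode_mem : ∀ a ∈ toSubalgebra, HopfAlgebra.antipode k a ∈ toSubalgebra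

namespace HopfSubalgebra

variable {k : Type*} {H : Type*} [Field k] [Ring H] [HopfAlgebra k H]

/-- The canonical map `A ⊗ A → H ⊗ H`. -/
abbrev incl₂ (A : HopfSubalgebra k H) :
    A.toSubalgebra ⊗[k] A.toSubalgebra →ₐ[k] H ⊗[k] H :=
  Algebra.TensorProduct.map A.toSubalgebra.val A.toSubalgebra.val

lemma val_injective (A : HopfSubalgebra k H) :
    Function.Injective A.toSubalgebra.val.toLinearMap := Subtype.val_injective

lemma incl₂_injective (A : HopfSubalgebra k H) : Function.Injective A.incl₂ :=
  TensorProduct.map_injective_of_flat_flat' A.toSubalgebra.val.toLinearMap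
    A.toSubalgebra.val.toLinearMap A.val_injective A.val_injective

/-- The comultiplication of `H` restricted to a map `A → A ⊗ A`. -/
def comulHom (A : HopfSubalgebra k H) :
    A.toSubalgebra →ₐ[k] A.toSubalgebra ⊗[k] A.toSubalgebra :=
  (AlgEquiv.ofInjective A.incl₂ A.incl₂_injective).symm.toAlgHom.comp
    (((Bialgebra.comulAlgHom k H).comp A.toSubalgebra.val).codRestrict A.incl₂.range
      fun a => A.comul_mem a a.2)

lemma incl₂_comulHom (A : HopfSubalgebra k H) (a : A.toSubalgebra) :
    A.incl₂ (A.comulHom a) = Coalgebra.comul (R := k) (a : H) :=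
  congrArg Subtype.val ((AlgEquiv.ofInjective A.incl₂ A.incl₂_injective).apply_symm_apply
    ⟨Coalgebra.comul (R := k) (a : H), A.comul_mem a a.2⟩)

lemma incl₃_left (A : HopfSubalgebra k H) (t : A.toSubalgebra ⊗[k] A.toSubalgebra) :
    TensorProduct.map A.toSubalgebra.val.toLinearMap
        (TensorProduct.map A.toSubalgebra.val.toLinearMap A.toSubalgebra.val.toLinearMap)
      (TensorProduct.assoc k _ _ _ (A.comulHom.toLinearMap.rTensor _ t)) =
    TensorProduct.assoc k H H H ((Coalgebra.comul (R := k)).rTensor H (A.incl₂ t)) := by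
  induction t with
  | zero => simp
  | add x y hx hy => simp only [map_add, hx, hy]
  | tmul a b =>
    have h := A.incl₂_comulHom a
    simp only [LinearMap.rTensor_tmul, Algebra.TensorProduct.map_tmul, AlgHom.toLinearMap_apply,
      Subalgebra.coe_val, ← h]
    generalize A.comulHom a = u
    induction u with
    | zero => simp
    | add x y hx hy => simp only [map_add, TensorProduct.add_tmul, hx, hy]
    | tmul x y => simp

lemma incl₃_right (A : HopfSubalgebra k H) (t : A.toSubalgebra ⊗[k] A.toSubalgebra) :
    TensorProduct.map A.toSubalgebra.val.toLinearMap
        (TensorProduct.map A.toSubalgebra.val.toLinearMap A.toSubalgebra.val.toLinearMap)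
      (A.comulHom.toLinearMap.lTensor _ t) =
    (Coalgebra.comul (R := k)).lTensor H (A.incl₂ t) := by
  induction t with
  | zero => simp
  | add x y hx hy => simp only [map_add, hx, hy]
  | tmul a b =>
    have h := A.incl₂_comulHom b
    simp only [LinearMap.lTensor_tmul, Algebra.TensorProduct.map_tmul, AlgHom.toLinearMap_apply,
      Subalgebra.coe_val, ← h]
    rfl

lemma incl₃_injective (A : HopfSubalgebra k H) : Function.Injective
    (TensorProduct.map A.toSubalgebra.val.toLinearMap
      (TensorProduct.map A.toSubalgebra.val.toLinearMap A.toSubalgebra.val.toLinearMap)) :=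
  TensorProduct.map_injective_of_flat_flat' _ _ A.val_injective A.incl₂_injective

/-- The antipode of `H` restricted to `A`. -/
def antipodeMap (A : HopfSubalgebra k H) : A.toSubalgebra →ₗ[k] A.toSubalgebra :=
  (HopfAlgebra.antipode k (A := H)).restrict (p := Subalgebra.toSubmodule A.toSubalgebra)
    (q := Subalgebra.toSubmodule A.toSubalgebra) A.antipode_mem

/-- The bialgebra structure on a Hopf subalgebra, restricted from `H`. -/
instance (A : HopfSubalgebra k H) : Bialgebra k A.toSubalgebra :=
  Bialgebra.ofAlgHom A.comulHom ((Bialgebra.counitAlgHom k H).comp A.toSubalgebra.val)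
    (by
      ext1 a
      apply A.incl₃_injective
      refine (A.incl₃_left (A.comulHom a)).trans
        (Eq.trans ?_ (A.incl₃_right (A.comulHom a)).symm)
      rw [incl₂_comulHom, Coalgebra.coassoc_apply])
    (by
      ext1 a
      apply (TensorProduct.lid k A.toSubalgebra).injective
      apply Subtype.val_injective
      have h (t : A.toSubalgebra ⊗[k] A.toSubalgebra) :
          ((TensorProduct.lid k A.toSubalgebra (TensorProduct.map
            ((Coalgebra.counit (R := k)) ∘ₗ A.toSubalgebra.val.toLinearMap) LinearMap.id t) :
              A.toSubalgebra) : H) =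
          TensorProduct.lid k H ((Coalgebra.counit (R := k)).rTensor H (A.incl₂ t)) := by
        induction t with
        | zero => simp
        | add x y hx hy => simp only [map_add, Subalgebra.coe_add, hx, hy]
        | tmul x y => simp
      refine (h (A.comulHom a)).trans ?_
      rw [incl₂_comulHom, Coalgebra.rTensor_counit_comul]
      simp)
    (by
      ext1 a
      apply (TensorProduct.rid k A.toSubalgebra).injective
      apply Subtype.val_injective
      have h (t : A.toSubalgebra ⊗[k] A.toSubalgebra) :
          ((TensorProduct.rid k A.toSubalgebra (TensorProduct.map LinearMap.id
            ((Coalgebra.counit (R := k)) ∘ₗ A.toSubalgebra.val.toLinearMap) t) :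
              A.toSubalgebra) : H) =
          TensorProduct.rid k H ((Coalgebra.counit (R := k)).lTensor H (A.incl₂ t)) := by
        induction t with
        | zero => simp
        | add x y hx hy => simp only [map_add, Subalgebra.coe_add, hx, hy]
        | tmul x y => simp
      refine (h (A.comulHom a)).trans ?_
      rw [incl₂_comulHom, Coalgebra.lTensor_counit_comul]
      simp)

/-- The Hopf algebra structure on a Hopf subalgebra, restricted from `H`. -/
instance (A : HopfSubalgebra k H) : HopfAlgebra k A.toSubalgebra where
  antipode := A.antipodeMap
  mul_antipode_rTensor_comul := by
    ext a
    have h (t : A.toSubalgebra ⊗[k] A.toSubalgebra) :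
        ((LinearMap.mul' k A.toSubalgebra (A.antipodeMap.rTensor _ t) : A.toSubalgebra) : H) =
        LinearMap.mul' k H ((HopfAlgebra.antipode k).rTensor H (A.incl₂ t)) := by
      induction t with
      | zero => simp
      | add x y hx hy => simp only [map_add, Subalgebra.coe_add, hx, hy]
      | tmul x y => simp [antipodeMap]; rfl
    refine (h (A.comulHom a)).trans ?_
    rw [incl₂_comulHom, HopfAlgebra.mul_antipode_rTensor_comul_apply]
    rfl
  mul_antipode_lTensor_comul := by
    ext a
    have h (t : A.toSubalgebra ⊗[k] A.toSubalgebra) :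
        ((LinearMap.mul' k A.toSubalgebra (A.antipodeMap.lTensor _ t) : A.toSubalgebra) : H) =
        LinearMap.mul' k H ((HopfAlgebra.antipode k).lTensor H (A.incl₂ t)) := by
      induction t with
      | zero => simp
      | add x y hx hy => simp only [map_add, Subalgebra.coe_add, hx, hy]
      | tmul x y => simp [antipodeMap]; rfl
    refine (h (A.comulHom a)).trans ?_
    rw [incl₂_comulHom, HopfAlgebra.mul_antipode_lTensor_comul_apply]
    rfl

/-- For fixed `a`, the linear map `h ↦ ∑ h₁ a S(h₂)`. -/
def leftAdjoint (k : Type*) {H : Type*} [Field k] [Ring H] [HopfAlgebra k H] (a : H) :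
    H →ₗ[k] H :=
  LinearMap.mul' k H ∘ₗ
    TensorProduct.map (LinearMap.mulRight k a) (HopfAlgebra.antipode k) ∘ₗ Coalgebra.comul

/-- For fixed `a`, the linear map `h ↦ ∑ S(h₁) a h₂`. -/
def rightAdjoint (k : Type*) {H : Type*} [Field k] [Ring H] [HopfAlgebra k H] (a : H) :
    H →ₗ[k] H :=
  LinearMap.mul' k H ∘ₗ
    TensorProduct.map (LinearMap.mulRight k a ∘ₗ HopfAlgebra.antipode k) LinearMap.id ∘ₗ
      Coalgebra.comul

/-- A Hopf subalgebra is normal if it is stable under both adjoint actions of `H`. -/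
def IsNormal (A : HopfSubalgebra k H) : Prop :=
  ∀ h : H, ∀ a ∈ A.toSubalgebra,
    leftAdjoint k a h ∈ A.toSubalgebra ∧ rightAdjoint k a h ∈ A.toSubalgebra

end HopfSubalgebra

/-- The (right) coinvariants `H^{co π} = {h | (id ⊗ π)(Δ h) = h ⊗ 1}` of a map of
Hopf algebras `π : H → A`, a subalgebra of `H`. -/
def coinvariants {k H A : Type*} [Field k] [Ring H] [HopfAlgebra k H] [Ring A] [HopfAlgebra k A]
    (π : H →ₐc[k] A) : Subalgebra k H :=
  AlgHom.equalizer
    ((Algebra.TensorProduct.map (AlgHom.id k H) (π : H →ₐ[k] A)).comp (Bialgebra.comulAlgHom k H))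
    (Algebra.TensorProduct.includeLeft : H →ₐ[k] H ⊗[k] A)

end

/-! Call a right coideal V of a Hopf algebra L (Δ(V) ⊆ V ⊗ L) that is stable under left
multiplication by an embedded Hopf algebra B admissible. A count in the style of Nichols and Zoeller
gives dim B · dim Hom_B(V, k) ≤ dim V (`finrank_mul_finrank_invDual_subRep_le`). If 1 ∈ V and
Hom_B(V, k) is at most one-dimensional, a right integral of B forces V ⊆ B. Together: an admissible
V containing 1 with dim V < 2 dim B lies in B (`le_range_of_finrank_lt`).

For (a), these facts for A* ⊆ H* with V = H* show that R = H^{co π} has dimension 2, so R = k1 + kx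
with ε(x) = 0. Since Δ(R) ⊆ H ⊗ R and R is stable under the left adjoint action, Δ(x) = x ⊗ 1 + g ⊗
x with g grouplike, and ax = xT(a), where T(a) = ∑ χ(a₁)a₂ for a character χ. Write x² = αx;
comparing Δ(x²) with αΔ(x) gives (χ(g) + 1)x = α(1 − g).

If χ(g) ≠ −1, then x is a multiple of 1 − g, and g turns out to be a central involution spanning R
together with 1. If χ(g) = −1, then x² = 0 and T negates both x and g. The annihilator of xH in H*
is admissible over A*, contains 1 and is proper, so it equals A* and dim xH = n. On xH, T and left
multiplication by g are injective and anticommute; determinants rule this out for odd n in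
characteristic zero.

For (b), the same result applied to the restriction H* → K* gives a central grouplike of H*, that
is, a central character σ ≠ ε of H that agrees with ε on K. The fixed points of translation by σ are
admissible over K and proper, hence equal to K, and they are stable under both adjoint actions. -/

noncomputable section

/-! ### Convolution identities for the antipode. -/

namespace HopfAlgebra

open Coalgebra WithConv TensorProduct

section Convolution

variable {k H E : Type*} [Field k] [Ring H] [HopfAlgebra k H] [Ring E] [Algebra k E]

lemma algHom_conv_antipode (φ : H →ₐ[k] E) :
    toConv φ.toLinearMap * toConv (φ.toLinearMap ∘ₗ antipode k) = 1 := by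
  have := LinearMap.algHom_comp_convMul_distrib φ (toConv LinearMap.id)
      (toConv (antipode k (A := H)))
  rw [LinearMap.id_mul_antipode] at this
  apply WithConv.ext
  refine this.symm.trans ?_
  ext x; simp [LinearMap.convOne_def]

lemma antipode_conv_algHom (φ : H →ₐ[k] E) :
    toConv (φ.toLinearMap ∘ₗ antipode k) * toConv φ.toLinearMap = 1 := by
  have := LinearMap.algHom_comp_convMul_distrib φ (toConv (antipode k (A := H)))
      (toConv LinearMap.id)
  rw [LinearMap.antipode_mul_id] at this
  apply WithConv.ext
  refine this.symm.trans ?_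
  ext x; simp [LinearMap.convOne_def]

lemma conv_apply_repr {a : H} {ι : Type*} (r : Coalgebra.Repr k a ι) (f g : H →ₗ[k] E) :
    (toConv f * toConv g) a = ∑ i ∈ r.index, f (r.left i) * g (r.right i) :=
  r.convMul_apply _ _

/-- `h ↦ h ⊗ 1` and `h ↦ 1 ⊗ h` convolve to the comultiplication. -/
lemma includeLeft_conv_includeRight :
    toConv (Algebra.TensorProduct.includeLeft : H →ₐ[k] H ⊗[k] H).toLinearMap *
      toConv (Algebra.TensorProduct.includeRight : H →ₐ[k] H ⊗[k] H).toLinearMap =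
      toConv (comul (R := k) (A := H)) := by
  ext a
  change _ = comul a
  rw [conv_apply_repr (ℛ k a)]
  conv_rhs => rw [← (ℛ k a).eq]
  simp

/-- Δ is the convolution product of h ↦ h ⊗ 1 and h ↦ 1 ⊗ h, so convolving on the right with the
inverse of the second factor leaves the first. -/
lemma sum_comul_mul_antipode {a : H} {ι : Type*} (r : Coalgebra.Repr k a ι) :
    ∑ i ∈ r.index, comul (R := k) (r.left i) * (1 ⊗ₜ[k] antipode k (r.right i)) = a ⊗ₜ[k] 1 := by
  have h := includeLeft_conv_includeRight (k := k) (H := H)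
  have h2 := congr(($h * toConv ((Algebra.TensorProduct.includeRight : H →ₐ[k] H ⊗[k] H).toLinearMap
    ∘ₗ antipode k)) a)
  rw [mul_assoc, algHom_conv_antipode, mul_one, conv_apply_repr r] at h2
  simpa using! h2.symm

lemma sum_antipode_mul_comul {a : H} {ι : Type*} (r : Coalgebra.Repr k a ι) :
    ∑ i ∈ r.index, (antipode k (r.left i) ⊗ₜ[k] 1) * comul (R := k) (r.right i) = 1 ⊗ₜ[k] a := by
  have h := includeLeft_conv_includeRight (k := k) (H := H)
  have h2 := congr((toConv ((Algebra.TensorProduct.includeLeft : H →ₐ[k] H ⊗[k] H).toLinearMap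
    ∘ₗ antipode k) * $h) a)
  rw [← mul_assoc, antipode_conv_algHom, one_mul, conv_apply_repr r] at h2
  simpa using! h2.symm

/-- Both sides invert Δ for convolution: the right side from the left, the left side from the right.
-/
lemma comul_antipode (a : H) : comul (R := k) (antipode k a) =
    TensorProduct.map (antipode k) (antipode k) (TensorProduct.comm k H H (comul a)) := by
  set ι₁ := (Algebra.TensorProduct.includeLeft : H →ₐ[k] H ⊗[k] H)
  set ι₂ := (Algebra.TensorProduct.includeRight : H →ₐ[k] H ⊗[k] H)
  have h : toConv ι₁.toLinearMap * toConv ι₂.toLinearMap = toConv (comul (R := k) (A := H)) :=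
    includeLeft_conv_includeRight
  have h1 : toConv (ι₂.toLinearMap ∘ₗ antipode k) * toConv (ι₁.toLinearMap ∘ₗ antipode k) *
      toConv (comul (R := k) (A := H)) = 1 := by
    rw [← h, mul_assoc, ← mul_assoc (toConv (ι₁.toLinearMap ∘ₗ antipode k)),
      antipode_conv_algHom, one_mul, antipode_conv_algHom]
  have h2 : toConv (comul (R := k) (A := H)) * toConv (comul ∘ₗ antipode k) = 1 :=
    algHom_conv_antipode (Bialgebra.comulAlgHom k H)
  have h3 := congr($(left_inv_eq_right_inv h1 h2) a)
  refine h3.symm.trans ?_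
  rw [conv_apply_repr (ℛ k a)]
  conv_rhs => rw [← (ℛ k a).eq]
  simp [ι₁, ι₂]

end Convolution

end HopfAlgebra

/-! ### Tensor products of representations and the existence of integrals. -/

namespace HopfAlgebra

open Coalgebra WithConv TensorProduct Module

section Rep

variable {k B X Y : Type*} [Field k] [Ring B] [HopfAlgebra k B]
  [AddCommGroup X] [Module k X] [AddCommGroup Y] [Module k Y]

/-- The action of `B ⊗ B` on the tensor product of two representations of `B`. -/
def tensorAction (ρ : B →ₐ[k] End k X) (σ : B →ₐ[k] End k Y) : B ⊗[k] B →ₐ[k] End k (X ⊗[k] Y) :=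
  (Module.endTensorEndAlgHom (R := k) (S := k) (A := k)).comp (Algebra.TensorProduct.map ρ σ)

@[simp] lemma tensorAction_tmul (ρ : B →ₐ[k] End k X) (σ : B →ₐ[k] End k Y) (a b : B) (x : X)
    (y : Y) : tensorAction ρ σ (a ⊗ₜ b) (x ⊗ₜ y) = ρ a x ⊗ₜ σ b y := rfl

/-- The diagonal action on the tensor product of two representations. -/
def tensorRep (ρ : B →ₐ[k] End k X) (σ : B →ₐ[k] End k Y) : B →ₐ[k] End k (X ⊗[k] Y) :=
  (tensorAction ρ σ).comp (Bialgebra.comulAlgHom k B)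

lemma tensorRep_apply (ρ : B →ₐ[k] End k X) (σ : B →ₐ[k] End k Y) (b : B) :
    tensorRep ρ σ b = tensorAction ρ σ (comul b) := rfl

lemma tensorRep_repr (ρ : B →ₐ[k] End k X) (σ : B →ₐ[k] End k Y) {b : B} {ι : Type*}
    (r : Coalgebra.Repr k b ι) :
    tensorRep ρ σ b = ∑ i ∈ r.index, TensorProduct.map (ρ (r.left i)) (σ (r.right i)) := by
  rw [tensorRep_apply, ← r.eq, map_sum]
  rfl

/-- The map `b ⊗ x ↦ b₁ ⊗ b₂ x`. -/
def galois (ρ : B →ₐ[k] End k X) : B ⊗[k] X →ₗ[k] B ⊗[k] X :=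
  TensorProduct.lift <| LinearMap.compr₂
    (((tensorAction (Algebra.lmul k B) ρ).toLinearMap ∘ₗ comul).compl₂ (TensorProduct.mk k B X 1))
    LinearMap.id

@[simp] lemma galois_tmul (ρ : B →ₐ[k] End k X) (b : B) (x : X) :
    galois ρ (b ⊗ₜ x) = tensorAction (Algebra.lmul k B) ρ (comul b) (1 ⊗ₜ x) := rfl

/-- Multiplicativity of Δ makes the Galois map exchange the action on B alone for the diagonal
action; this trivializes X whenever it is tensored with B. -/
lemma galois_mul (ρ : B →ₐ[k] End k X) (a : B) (t : B ⊗[k] X) :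
    galois ρ ((Algebra.lmul k B a).rTensor X t) =
      tensorRep (Algebra.lmul k B) ρ a (galois ρ t) := by
  induction t with
  | zero => simp
  | add x y hx hy => simp only [map_add, hx, hy]
  | tmul b x =>
    simp [tensorRep_apply]

lemma galois_sum (ρ : B →ₐ[k] End k X) {b : B} {ι : Type*} (r : Coalgebra.Repr k b ι) (x : X) :
    ∑ i ∈ r.index, galois ρ (r.left i ⊗ₜ ρ (antipode k (r.right i)) x) = b ⊗ₜ x := by
  have h := congr(tensorAction (Algebra.lmul k B) ρ $(sum_comul_mul_antipode r) (1 ⊗ₜ x))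
  simpa [LinearMap.sum_apply] using! h

lemma galois_surjective (ρ : B →ₐ[k] End k X) : Function.Surjective (galois ρ) := by
  intro t
  induction t with
  | zero => exact ⟨0, map_zero _⟩
  | add x y hx hy =>
    obtain ⟨a, rfl⟩ := hx; obtain ⟨b, rfl⟩ := hy
    exact ⟨a + b, map_add _ _ _⟩
  | tmul b x => exact ⟨_, by rw [map_sum]; exact galois_sum ρ (ℛ k b) x⟩

end Rep

section Integral

variable {k B : Type*} [Field k] [Ring B] [HopfAlgebra k B]

/-- The action of `B` on its dual, `(a f)(y) = f (S(a) y)`. -/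
def dualRep (k B : Type*) [Field k] [Ring B] [HopfAlgebra k B] : B →ₐ[k] End k (Dual k B) :=
  AlgHom.ofLinearMap
    (LinearMap.flip (LinearMap.llcomp k B B k) ∘ₗ LinearMap.mul k B ∘ₗ antipode k)
    (by ext; simp) (fun a b => by ext; simp [antipode_mul_antidistrib, mul_assoc])

@[simp] lemma dualRep_apply (a : B) (f : Dual k B) (y : B) :
    dualRep k B a f y = f (antipode k a * y) := rfl

variable [FiniteDimensional k B]

/-- The identity of B, seen in B ⊗ B*, is invariant under the diagonal action because ∑ a₁S(a₂) =
ε(a). Its preimage under the Galois map is invariant under multiplication on the first factor alone,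
and a nonzero contraction of the second factor is a left integral. -/
lemma exists_left_integral [Nontrivial B] :
    ∃ t : B, t ≠ 0 ∧ ∀ a : B, a * t = counit (R := k) a • t := by
  let Φ : B ⊗[k] Dual k B ≃ₗ[k] End k B :=
    (TensorProduct.comm k B (Dual k B)).trans (dualTensorHomEquiv k B B)
  have hΦ (a b : B) (t : B ⊗[k] Dual k B) : Φ (TensorProduct.map (Algebra.lmul k B a)
      (dualRep k B b) t)
      = LinearMap.mulLeft k a ∘ₗ Φ t ∘ₗ LinearMap.mulLeft k (antipode k b) := by
    induction t with
    | zero => simp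
    | add x y hx hy => simp only [map_add, hx, hy, LinearMap.comp_add, LinearMap.add_comp]
    | tmul b x => ext; simp [Φ]
  set c := Φ.symm LinearMap.id with hc
  have hc0 : c ≠ 0 := by
    intro h
    have : (LinearMap.id : End k B) = 0 := by simpa [hc] using h
    exact one_ne_zero (LinearMap.congr_fun this (1 : B))
  have hinv (a : B) : tensorRep (Algebra.lmul k B) (dualRep k B) a c = counit (R := k) a • c := by
    apply Φ.injective
    rw [tensorRep_repr _ _ (ℛ k a), LinearMap.sum_apply, map_sum]
    simp only [hΦ]
    ext z
    have := congr($(sum_mul_antipode_eq_smul (ℛ k a)) * z)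
    simpa [c, Finset.sum_mul, mul_assoc] using this
  obtain ⟨d, hd⟩ := galois_surjective (dualRep k B) c
  have hd0 : d ≠ 0 := by rintro rfl; exact hc0 (by rw [← hd, map_zero])
  have hinj : Function.Injective (galois (dualRep k B)) :=
    LinearMap.injective_iff_surjective.mpr (galois_surjective _)
  have hd1 (a : B) : (Algebra.lmul k B a).rTensor (Dual k B) d = counit (R := k) a • d :=
    hinj (by rw [galois_mul, hd, hinv, map_smul, hd])
  obtain ⟨F, hF⟩ : ∃ F : Dual k (Dual k B), TensorProduct.rid k B (F.lTensor B d) ≠ 0 := by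
    by_contra! h
    apply hd0
    let b := Module.finBasis k (Dual k B)
    have := b.equivFun
    apply (TensorProduct.equivFinsuppOfBasisRight (M := B) b).injective
    ext i
    simpa [TensorProduct.equivFinsuppOfBasisRight_apply] using h (b.coord i)
  refine ⟨_, hF, fun a => ?_⟩
  have h2 : ∀ t : B ⊗[k] Dual k B, a * TensorProduct.rid k B (F.lTensor B t) =
      TensorProduct.rid k B (F.lTensor B ((Algebra.lmul k B a).rTensor (Dual k B) t)) := by
    intro t
    induction t with
    | zero => simp
    | add x y hx hy => simp only [map_add, hx, hy, mul_add]
    | tmul b x => simp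
  rw [h2, hd1, map_smul, map_smul]

end Integral

end HopfAlgebra

/-! ### Contractions, and bijectivity of the antipode in finite dimension. -/

namespace HopfAlgebra

open Coalgebra WithConv TensorProduct Module

section Contract

variable {k M N : Type*} [Field k] [AddCommGroup M] [Module k M] [AddCommGroup N] [Module k N]

/-- The contraction `m ⊗ n ↦ f(m) n`. -/
def contractLeft (f : Dual k M) : M ⊗[k] N →ₗ[k] N := (TensorProduct.lid k N).toLinearMap ∘ₗ
    f.rTensor N

/-- The contraction `m ⊗ n ↦ f(n) m`. -/
def contractRight (f : Dual k N) : M ⊗[k] N →ₗ[k] M := (TensorProduct.rid k M).toLinearMap ∘ₗ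
    f.lTensor M

@[simp] lemma contractLeft_tmul (f : Dual k M) (m : M) (n : N) :
    contractLeft f (m ⊗ₜ n) = f m • n := by simp [contractLeft]

@[simp] lemma contractRight_tmul (f : Dual k N) (m : M) (n : N) :
    contractRight f (m ⊗ₜ n) = f n • m := by simp [contractRight]

lemma sum_basis_tmul_contractLeft {ι : Type*} [Fintype ι] (b : Basis ι k M) (t : M ⊗[k] N) :
    ∑ i, b i ⊗ₜ[k] contractLeft (b.coord i) t = t := by
  induction t with
  | zero => simp
  | add x y hx hy => simp only [map_add, tmul_add, Finset.sum_add_distrib, hx, hy]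
  | tmul m n =>
    simp only [contractLeft_tmul, tmul_smul, Basis.coord_apply, smul_tmul', ← sum_tmul, b.sum_repr]

lemma sum_contractRight_tmul_basis {ι : Type*} [Fintype ι] (b : Basis ι k N) (t : M ⊗[k] N) :
    ∑ i, contractRight (b.coord i) t ⊗ₜ[k] b i = t := by
  induction t with
  | zero => simp
  | add x y hx hy => simp only [map_add, add_tmul, Finset.sum_add_distrib, hx, hy]
  | tmul m n =>
    simp only [contractRight_tmul, Basis.coord_apply, smul_tmul, ← tmul_sum, b.sum_repr]

lemma contractLeft_counit_comul {H : Type*} [AddCommGroup H] [Module k H] [Coalgebra k H] (a : H) :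
    contractLeft (counit (R := k)) (comul (R := k) a) = a := by
  simp [contractLeft]

lemma contractRight_counit_comul {H : Type*} [AddCommGroup H] [Module k H] [Coalgebra k H] (a : H) :
    contractRight (counit (R := k)) (comul (R := k) a) = a := by
  simp [contractRight]

lemma tensor_ext_contractLeft [FiniteDimensional k M] {s t : M ⊗[k] N}
    (h : ∀ f : Dual k M, contractLeft f s = contractLeft f t) : s = t := by
  rw [← sum_basis_tmul_contractLeft (Module.finBasis k M) s,
    ← sum_basis_tmul_contractLeft (Module.finBasis k M) t]
  simp [h]

lemma tensor_ext_contractRight [FiniteDimensional k N] {s t : M ⊗[k] N}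
    (h : ∀ f : Dual k N, contractRight f s = contractRight f t) : s = t := by
  rw [← sum_contractRight_tmul_basis (Module.finBasis k N) s,
    ← sum_contractRight_tmul_basis (Module.finBasis k N) t]
  simp [h]

end Contract

section Antipode

variable {k B : Type*} [Field k] [Ring B] [HopfAlgebra k B]

/-- Write 1 ⊗ h = ∑ (S(h₁) ⊗ 1)Δ(h₂); the integral absorbs Δ(h₂) as ε(h₂). -/
lemma one_tmul_mul_comul_integral {t : B} (ht : ∀ a : B, a * t = counit (R := k) a • t) (h : B) :
    (1 ⊗ₜ[k] h) * comul (R := k) t = (antipode k h ⊗ₜ[k] 1) * comul (R := k) t := by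
  rw [← sum_antipode_mul_comul (ℛ k h), Finset.sum_mul]
  have h1 : ∀ i, (antipode k ((ℛ k h).left i) ⊗ₜ[k] (1 : B)) * comul (R := k) ((ℛ k h).right i) *
      comul (R := k) t =
      (antipode k (counit (R := k) ((ℛ k h).right i) • (ℛ k h).left i) ⊗ₜ[k] (1 : B)) *
      comul (R := k) t := by
    intro i
    rw [mul_assoc, ← Bialgebra.comul_mul]
    rw [ht, map_smul, map_smul, mul_smul_comm, ← smul_tmul', smul_mul_assoc]
  simp_rw [h1]
  rw [← Finset.sum_mul, ← sum_tmul, ← map_sum]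
  congr 3
  have := contractRight_counit_comul (k := k) h
  rw [← (ℛ k h).eq] at this
  simpa using this

/-- Write v ⊗ 1 = ∑ Δ(v₁)(1 ⊗ S(v₂)) and let r absorb v₁. Only the left legs of Δ(v) must be
absorbed, so r may be an integral of a Hopf subalgebra and v an element of a right coideal. -/
lemma comul_mul_tmul_one_of_integral {r v : B} {ι : Type*} (R : Coalgebra.Repr k v ι)
    (hr : ∀ i ∈ R.index, r * R.left i = counit (R := k) (R.left i) • r) :
    comul (R := k) r * (v ⊗ₜ[k] 1) = comul (R := k) r * (1 ⊗ₜ[k] antipode k v) := by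
  rw [← sum_comul_mul_antipode R, Finset.mul_sum]
  have h1 : ∀ i ∈ R.index, comul (R := k) r * (comul (R := k) (R.left i) *
      ((1 : B) ⊗ₜ[k] antipode k (R.right i))) =
      comul (R := k) r * (1 ⊗ₜ[k] antipode k (counit (R := k) (R.left i) • R.right i)) := by
    intro i hi
    rw [← mul_assoc, ← Bialgebra.comul_mul, hr i hi]
    simp
  rw [Finset.sum_congr rfl h1, ← Finset.mul_sum, ← tmul_sum, ← map_sum]
  congr 3
  have := contractLeft_counit_comul (k := k) v
  rw [← R.eq] at this
  simpa using this

variable [FiniteDimensional k B]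

/-- Choose f₀ with f₀(t) = 1 and put m = ∑ f₀(t₁)t₂, so that ε(m) = 1. The identity ∑ S(m₁)m₂ = 1
then writes 1 as a combination of contractions of Δ(t) multiplied on the left, and these multipliers
can be moved to the first leg of Δ(t). -/
lemma exists_contractLeft_comul_integral {t : B} (ht0 : t ≠ 0)
    (ht : ∀ a : B, a * t = counit (R := k) a • t) :
    ∃ f : Dual k B, contractLeft f (comul (R := k) t) = 1 := by
  obtain ⟨f₀, hf₀⟩ := Module.Projective.exists_dual_eq_one k ht0
  let b := Module.finBasis k B
  let c i := contractLeft f₀ (comul (R := k) (b i))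
  -- Here Δ(m) = ∑ c i ⊗ (the contraction of Δ(t) by the i-th coordinate). The multiplier S(c i) on
  -- the second leg becomes S²(c i) on the first by `one_tmul_mul_comul_integral`.
  refine ⟨∑ i, b.coord i ∘ₗ LinearMap.mulLeft k (antipode k (antipode k (c i))), ?_⟩
  have hadd : ∀ (f : Fin (finrank k B) → Dual k B) (s : B ⊗[k] B),
      contractLeft (∑ i, f i) s = ∑ i, contractLeft (f i) s := by
    intro f s
    induction s with
    | zero => simp
    | add x y hx hy => simp only [map_add, hx, hy, Finset.sum_add_distrib]
    | tmul x y => simp [Finset.sum_smul]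
  have hleft : ∀ (f : Dual k B) (a : B) (s : B ⊗[k] B),
      contractLeft (f ∘ₗ LinearMap.mulLeft k a) s = contractLeft f ((a ⊗ₜ[k] 1) * s) := by
    intro f a s
    induction s with
    | zero => simp
    | add x y hx hy => simp only [map_add, mul_add, hx, hy]
    | tmul x y => simp
  have hright : ∀ (f : Dual k B) (a : B) (s : B ⊗[k] B),
      contractLeft f ((1 ⊗ₜ[k] a) * s) = a * contractLeft f s := by
    intro f a s
    induction s with
    | zero => simp
    | add x y hx hy => simp only [map_add, mul_add, hx, hy]
    | tmul x y => simp
  rw [hadd]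
  simp_rw [hleft, ← one_tmul_mul_comul_integral ht, hright]
  have hn : comul (R := k) (contractLeft f₀ (comul (R := k) t)) =
      ∑ i, c i ⊗ₜ[k] contractLeft (b.coord i) (comul (R := k) t) := by
    have h1 : ∀ s : B ⊗[k] B, comul (R := k) (contractLeft f₀ s) =
        contractLeft f₀ ((comul (R := k)).lTensor B s) := by
      intro s
      induction s with
      | zero => simp
      | add x y hx hy => simp only [map_add, hx, hy]
      | tmul x y => simp
    have h2 : ∀ s : (B ⊗[k] B) ⊗[k] B, contractLeft f₀ (TensorProduct.assoc k B B B s) =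
        (contractLeft f₀).rTensor B s := by
      intro s
      induction s with
      | zero => simp
      | add x y hx hy => simp only [map_add, hx, hy]
      | tmul x y =>
        induction x with
        | zero => simp
        | add x y hx hy => simp only [map_add, add_tmul, hx, hy]
        | tmul x z => simp [smul_tmul']
    rw [h1, ← Coalgebra.coassoc_apply, h2]
    conv_lhs => rw [← sum_basis_tmul_contractLeft b (comul (R := k) t)]
    simp [c]
  have h3 := mul_antipode_rTensor_comul_apply (R := k) (contractLeft f₀ (comul (R := k) t))
  rw [hn] at h3
  simp only [map_sum, LinearMap.rTensor_tmul, LinearMap.mul'_apply] at h3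
  rw [h3]
  have h4 : counit (R := k) (contractLeft f₀ (comul (R := k) t)) = f₀ t := by
    conv_rhs => rw [← contractRight_counit_comul (k := k) t]
    generalize comul (R := k) t = s
    induction s with
    | zero => simp
    | add x y hx hy => simp only [map_add, hx, hy]
    | tmul x y => simp [mul_comm]
  rw [h4, hf₀, map_one]

/-- If S(h) = 0 then (1 ⊗ h)Δ(t) = 0 for a left integral t; contracting the first leg so that Δ(t)
becomes 1 leaves h = 0. -/
lemma antipode_bijective : Function.Bijective (antipode k : B →ₗ[k] B) := by
  rcases subsingleton_or_nontrivial B with hB | hB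
  · exact ⟨Function.injective_of_subsingleton _, fun x => ⟨0, Subsingleton.elim _ _⟩⟩
  have hinj : Function.Injective (antipode k : B →ₗ[k] B) := by
    obtain ⟨t, ht0, ht⟩ := exists_left_integral (k := k) (B := B)
    obtain ⟨f, hf⟩ := exists_contractLeft_comul_integral ht0 ht
    rw [injective_iff_map_eq_zero]
    intro h hh
    have h1 := one_tmul_mul_comul_integral ht h
    rw [hh, zero_tmul, zero_mul] at h1
    have hright : ∀ (s : B ⊗[k] B),
        contractLeft f ((1 ⊗ₜ[k] h) * s) = h * contractLeft f s := by
      intro s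
      induction s with
      | zero => simp
      | add x y hx hy => simp only [map_add, mul_add, hx, hy]
      | tmul x y => simp
    have h2 := hright (comul t)
    rw [h1, hf, map_zero, mul_one] at h2
    exact h2.symm
  exact ⟨hinj, LinearMap.injective_iff_surjective.mp hinj⟩

/-- A finite-dimensional Hopf algebra has a right integral whose comultiplication has full
left support. -/
lemma exists_right_integral [Nontrivial B] : ∃ (r : B) (f : Dual k B),
    (∀ a : B, r * a = counit (R := k) a • r) ∧ contractRight f (comul (R := k) r) = 1 := by
  obtain ⟨t, ht0, ht⟩ := exists_left_integral (k := k) (B := B)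
  obtain ⟨f, hf⟩ := exists_contractLeft_comul_integral ht0 ht
  let e : B ≃ₗ[k] B := LinearEquiv.ofBijective (antipode k) antipode_bijective
  -- S reverses products and coproducts, so S(t) is a right integral and f ∘ S⁻¹ on its second leg
  -- reads off f on the first leg of Δ(t).
  refine ⟨antipode k t, f ∘ₗ e.symm.toLinearMap, fun a => ?_, ?_⟩
  · obtain ⟨a, rfl⟩ := (antipode_bijective (k := k) (B := B)).2 a
    rw [← antipode_mul_antidistrib, ht, map_smul, counit_antipode]
  · rw [comul_antipode, ← antipode_one (R := k), ← hf]
    generalize comul (R := k) t = s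
    induction s with
    | zero => simp
    | add x y hx hy => simp only [map_add, hx, hy]
    | tmul x y =>
      have : e.symm (antipode k x) = x := e.symm_apply_apply x
      simp [this]

end Antipode

end HopfAlgebra

/-! ### Invariant functionals on representations. -/

namespace HopfAlgebra

open Coalgebra WithConv TensorProduct Module

section Rep

variable {k B X Y Z : Type*} [Field k] [Ring B] [HopfAlgebra k B]
  [AddCommGroup X] [Module k X] [AddCommGroup Y] [Module k Y] [AddCommGroup Z] [Module k Z]

variable (k B X) in
/-- The trivial representation. -/
def trivRep : B →ₐ[k] End k X := (Algebra.ofId k (End k X)).comp (Bialgebra.counitAlgHom k B)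

@[simp] lemma trivRep_apply (b : B) (x : X) : trivRep k B X b x = counit (R := k) b • x := rfl

lemma tensorRep_trivRep (ρ : B →ₐ[k] End k X) (b : B) :
    tensorRep ρ (trivRep k B Y) b = (ρ b).rTensor Y := by
  rw [tensorRep_repr _ _ (ℛ k b)]
  ext x y
  have h : ∑ i ∈ (ℛ k b).index, counit (R := k) ((ℛ k b).right i) • (ℛ k b).left i = b := by
    have := contractRight_counit_comul (k := k) b
    rw [← (ℛ k b).eq] at this
    simpa using this
  have h2 := congr(ρ $h x ⊗ₜ[k] y)
  simpa [LinearMap.sum_apply, sum_tmul, smul_tmul] using h2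

lemma tensorRep_map {X' Y' : Type*} [AddCommGroup X'] [Module k X'] [AddCommGroup Y'] [Module k Y']
    {ρ : B →ₐ[k] End k X} {σ : B →ₐ[k] End k Y} {ρ' : B →ₐ[k] End k X'} {σ' : B →ₐ[k] End k Y'}
    {f : X →ₗ[k] X'} {g : Y →ₗ[k] Y'} (hf : ∀ b x, f (ρ b x) = ρ' b (f x))
    (hg : ∀ b x, g (σ b x) = σ' b (g x)) (b : B) (t : X ⊗[k] Y) :
    TensorProduct.map f g (tensorRep ρ σ b t) = tensorRep ρ' σ' b (TensorProduct.map f g t) := by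
  simp only [tensorRep_repr _ _ (ℛ k b), LinearMap.sum_apply, map_sum]
  refine Finset.sum_congr rfl fun i _ => ?_
  induction t with
  | zero => simp
  | add x y hx hy => simp only [map_add, hx, hy]
  | tmul x y => simp [hf, hg]

lemma tensorRep_assoc (ρ : B →ₐ[k] End k X) (σ : B →ₐ[k] End k Y) (τ : B →ₐ[k] End k Z)
    (b : B) (t : (X ⊗[k] Y) ⊗[k] Z) :
    TensorProduct.assoc k X Y Z (tensorRep (tensorRep ρ σ) τ b t) =
      tensorRep ρ (tensorRep σ τ) b (TensorProduct.assoc k X Y Z t) := by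
  induction t with
  | zero => simp
  | add x y hx hy => simp only [map_add, hx, hy]
  | tmul u z =>
    induction u with
    | zero => simp
    | add x y hx hy => simp only [map_add, hx, hy, add_tmul]
    | tmul x y =>
      let T : B ⊗[k] (B ⊗[k] B) →ₗ[k] X ⊗[k] (Y ⊗[k] Z) :=
        TensorProduct.map (ρ.toLinearMap.flip x)
          (TensorProduct.map (σ.toLinearMap.flip y) (τ.toLinearMap.flip z))
      have hl : ∀ s : B ⊗[k] B, TensorProduct.assoc k X Y Z
          (tensorAction (tensorRep ρ σ) τ s ((x ⊗ₜ y) ⊗ₜ z)) =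
          T (TensorProduct.assoc k B B B ((comul (R := k)).rTensor B s)) := by
        intro s
        induction s with
        | zero => simp
        | add x y hx hy => simp only [map_add, hx, hy, LinearMap.add_apply]
        | tmul a c =>
          rw [tensorAction_tmul, tensorRep_apply, LinearMap.rTensor_tmul]
          generalize comul (R := k) a = s
          induction s with
          | zero => simp
          | add x y hx hy => simp only [map_add, hx, hy, LinearMap.add_apply, add_tmul]
          | tmul p q => simp [T]
      have hr : ∀ s : B ⊗[k] B, 
          (tensorAction ρ (tensorRep σ τ) s (x ⊗ₜ (y ⊗ₜ z))) =
          T ((comul (R := k)).lTensor B s) := by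
        intro s
        induction s with
        | zero => simp
        | add x y hx hy => simp only [map_add, hx, hy, LinearMap.add_apply]
        | tmul a c =>
          rw [tensorAction_tmul, tensorRep_apply, LinearMap.lTensor_tmul]
          generalize comul (R := k) c = s
          induction s with
          | zero => simp
          | add x y hx hy => simp only [map_add, hx, hy, LinearMap.add_apply, tmul_add]
          | tmul p q => simp [T]
      rw [tensorRep_apply, hl, coassoc_apply, ← hr, _root_.TensorProduct.assoc_tmul,
          tensorRep_apply]

/-- The invariant functionals on a representation. -/
def invDual (ρ : B →ₐ[k] End k X) : Submodule k (Dual k X) where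
  carrier := {F | ∀ b x, F (ρ b x) = counit (R := k) b * F x}
  add_mem' h₁ h₂ b x := by simp [h₁ b x, h₂ b x, mul_add]
  zero_mem' := by simp
  smul_mem' c F h b x := by simp [h b x]; ring

lemma mem_invDual {ρ : B →ₐ[k] End k X} {F : Dual k X} :
    F ∈ invDual ρ ↔ ∀ b x, F (ρ b x) = counit (R := k) b * F x := Iff.rfl

lemma finrank_invDual_le_of_surjective [FiniteDimensional k X]
    {ρ : B →ₐ[k] End k X} {σ : B →ₐ[k] End k Y}
    (f : X →ₗ[k] Y) (hf : ∀ b x, f (ρ b x) = σ b (f x)) (hs : Function.Surjective f) :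
    finrank k (invDual σ) ≤ finrank k (invDual ρ) := by
  let g : invDual σ →ₗ[k] invDual ρ := (f.dualMap).restrict (fun F hF b x => by
    simp only [LinearMap.dualMap_apply, hf]; exact hF b _)
  refine LinearMap.finrank_le_finrank_of_injective (f := g) fun F G h => ?_
  have h2 : f.dualMap F.1 = f.dualMap G.1 := congrArg Subtype.val h
  exact Subtype.ext (LinearMap.dualMap_injective_of_surjective hs h2)

/-- Taking invariant functionals is left exact: one that vanishes on the image of `i` descends along
`p` to an invariant functional on Z. -/
lemma finrank_invDual_le_of_exact [FiniteDimensional k X] [FiniteDimensional k Y]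
    [FiniteDimensional k Z]
    {ρ : B →ₐ[k] End k X} {σ : B →ₐ[k] End k Y} {τ : B →ₐ[k] End k Z}
    (i : Y →ₗ[k] X) (p : X →ₗ[k] Z) (hi : ∀ b x, i (σ b x) = ρ b (i x))
    (hp : ∀ b x, p (ρ b x) = τ b (p x)) (hs : Function.Surjective p) (he : Function.Exact i p) :
    finrank k (invDual ρ) ≤ finrank k (invDual σ) + finrank k (invDual τ) := by
  let g : invDual ρ →ₗ[k] invDual σ := (i.dualMap).restrict (fun F hF b x => by
    simp only [LinearMap.dualMap_apply, hi]; exact hF b _)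
  have hrk := LinearMap.finrank_range_add_finrank_ker (V := invDual ρ) (V₂ := invDual σ) g
  refine hrk.symm.le.trans (add_le_add (Submodule.finrank_le _) ?_)
  let h : invDual τ →ₗ[k] LinearMap.ker g := LinearMap.codRestrict _
    ((p.dualMap).restrict (fun F hF b x => by
      simp only [LinearMap.dualMap_apply, hp]; exact hF b _)) (fun F => by
        rw [LinearMap.mem_ker]
        ext y
        change F.1 (p (i y)) = 0
        rw [he.apply_apply_eq_zero, map_zero])
  refine LinearMap.finrank_le_finrank_of_surjective (f := h) ?_
  rintro ⟨⟨F, hF⟩, hF'⟩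
  have hF2 : ∀ y, F (i y) = 0 := fun y => LinearMap.congr_fun (congrArg Subtype.val hF') y
  have : F ∈ LinearMap.range p.dualMap := by
    rw [LinearMap.range_dualMap_eq_dualAnnihilator_ker, Submodule.mem_dualAnnihilator]
    intro x hx
    obtain ⟨y, rfl⟩ := (he x).mp hx
    exact hF2 y
  obtain ⟨F', rfl⟩ := this
  refine ⟨⟨F', fun b z => ?_⟩, rfl⟩
  obtain ⟨x, rfl⟩ := hs z
  rw [← hp]
  exact hF b x

/-- Tensoring with a trivial representation multiplies the number of invariants. -/
lemma finrank_mul_finrank_invDual_le [FiniteDimensional k X] [FiniteDimensional k Y]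
    (ρ : B →ₐ[k] End k X) :
    finrank k Y * finrank k (invDual ρ) ≤ finrank k (invDual (tensorRep ρ (trivRep k B Y))) := by
  let e := Module.finBasis k Y
  have hinv : ∀ (i : Fin (finrank k Y)) (F : invDual ρ),
      (contractRight (e.coord i)).dualMap F.1 ∈ invDual (tensorRep ρ (trivRep k B Y)) := by
    intro i F b t
    rw [tensorRep_trivRep]
    induction t with
    | zero => simp
    | add x y hx hy => simp only [map_add, hx, hy, mul_add]
    | tmul x y =>
      have := F.2 b x
      simp [this]; ring
  let g : (Fin (finrank k Y) → invDual ρ) →ₗ[k] invDual (tensorRep ρ (trivRep k B Y)) :=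
    ∑ i, LinearMap.codRestrict _ ((contractRight (e.coord i)).dualMap ∘ₗ (invDual ρ).subtype)
      (hinv i) ∘ₗ LinearMap.proj i
  have hg : ∀ φ i x, (g φ).1 (x ⊗ₜ e i) = (φ i).1 x := by
    intro φ i x
    have : (g φ).1 (x ⊗ₜ e i) = ∑ d, (φ d).1 (contractRight (e.coord d) (x ⊗ₜ e i)) := by
      simp only [g, LinearMap.sum_apply, AddSubmonoidClass.coe_finsetSum]
      rfl
    rw [this, Finset.sum_eq_single i (fun d _ hd => ?_) (by simp)]
    · simp
    · simp [hd.symm]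
  have hle := LinearMap.finrank_le_finrank_of_injective (f := g) (fun φ ψ h => by
    ext i x
    rw [← hg φ, h, hg])
  have := Module.Free.of_divisionRing k (invDual ρ)
  simpa [Module.finrank_pi_fintype] using hle

end Rep
end HopfAlgebra

/-! ### Invariants on tensor products with the regular representation, and stable right coideals. -/

namespace HopfAlgebra

open Coalgebra WithConv TensorProduct Module

section Free

variable {k B X W : Type*} [Field k] [Ring B] [HopfAlgebra k B]
  [AddCommGroup X] [Module k X] [AddCommGroup W] [Module k W]

lemma sum_comul_antipode_mul {a : B} {ι : Type*} (r : Coalgebra.Repr k a ι) :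
    ∑ i ∈ r.index, comul (R := k) (antipode k (r.left i)) * (r.right i ⊗ₜ[k] 1) =
      1 ⊗ₜ[k] antipode k a := by
  set ι₁ := (Algebra.TensorProduct.includeLeft : B →ₐ[k] B ⊗[k] B)
  set ι₂ := (Algebra.TensorProduct.includeRight : B →ₐ[k] B ⊗[k] B)
  have h : toConv ι₁.toLinearMap * toConv ι₂.toLinearMap = toConv (comul (R := k) (A := B)) :=
    includeLeft_conv_includeRight
  have h1 : toConv (ι₂.toLinearMap ∘ₗ antipode k) * toConv (ι₁.toLinearMap ∘ₗ antipode k) *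
      toConv (comul (R := k) (A := B)) = 1 := by
    rw [← h, mul_assoc, ← mul_assoc (toConv (ι₁.toLinearMap ∘ₗ antipode k)),
      antipode_conv_algHom, one_mul, antipode_conv_algHom]
  have h2 : toConv (comul (R := k) (A := B)) * toConv (comul ∘ₗ antipode k) = 1 :=
    algHom_conv_antipode (Bialgebra.comulAlgHom k B)
  have h3 := congr(($(left_inv_eq_right_inv h1 h2) * toConv ι₁.toLinearMap) a)
  rw [mul_assoc, antipode_conv_algHom, mul_one, conv_apply_repr r] at h3
  simpa [ι₁, ι₂] using! h3.symm

/-- The diagonal module X ⊗ B is generated by X ⊗ 1, because x ⊗ S(c) = ∑ S(c₁)·(c₂x ⊗ 1) and S is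
onto. -/
lemma eq_zero_of_tensorRep_lmul [FiniteDimensional k B] {ρ : B →ₐ[k] End k X}
    {F : Dual k (X ⊗[k] B)}
    (hF : F ∈ invDual (tensorRep ρ (Algebra.lmul k B))) (h1 : ∀ x, F (x ⊗ₜ 1) = 0) : F = 0 := by
  ext x b
  obtain ⟨c, rfl⟩ := (antipode_bijective (k := k) (B := B)).2 b
  have h := congr(F (tensorAction ρ (Algebra.lmul k B) $(sum_comul_antipode_mul (ℛ k c)) (x ⊗ₜ 1)))
  have h2 : ∀ b x, F (tensorAction ρ (Algebra.lmul k B) (comul b) (x ⊗ₜ 1)) = 0 := by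
    intro b x
    rw [← tensorRep_apply, hF, h1, mul_zero]
  simpa [LinearMap.sum_apply, h2] using h.symm

/-- The Galois map replaces W by a trivial module; an invariant functional is then determined by its
values on X ⊗ 1 ⊗ W. -/
lemma finrank_invDual_tensorRep_lmul_le [FiniteDimensional k B] [FiniteDimensional k X]
    [FiniteDimensional k W]
    (ρ : B →ₐ[k] End k X) (σ : B →ₐ[k] End k W) :
    finrank k (invDual (tensorRep ρ (tensorRep (Algebra.lmul k B) σ))) ≤
      finrank k X * finrank k W := by
  have h1 := finrank_invDual_le_of_surjective
    (ρ := tensorRep ρ (tensorRep (Algebra.lmul k B) (trivRep k B W)))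
    (σ := tensorRep ρ (tensorRep (Algebra.lmul k B) σ))
    (TensorProduct.map LinearMap.id (galois σ))
    (tensorRep_map (fun b x => rfl) (fun b t => by
      rw [tensorRep_trivRep, galois_mul]))
    (TensorProduct.map_surjective Function.surjective_id (galois_surjective σ))
  refine h1.trans ?_
  rw [← finrank_tensorProduct, ← Subspace.dual_finrank_eq]
  let i : X ⊗[k] W →ₗ[k] X ⊗[k] (B ⊗[k] W) := TensorProduct.map LinearMap.id
      (TensorProduct.mk k B W 1)
  refine LinearMap.finrank_le_finrank_of_injective (f := i.dualMap ∘ₗ Submodule.subtype _) ?_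
  rw [injective_iff_map_eq_zero]
  rintro ⟨F, hF⟩ h
  have h2 : ∀ x w, F (x ⊗ₜ (1 ⊗ₜ w)) = 0 := fun x w => LinearMap.congr_fun h (x ⊗ₜ w)
  ext x b w
  let q (w : W) : X ⊗[k] B →ₗ[k] X ⊗[k] (B ⊗[k] W) :=
    TensorProduct.map LinearMap.id ((TensorProduct.mk k B W).flip w)
  have h3 : F ∘ₗ q w = 0 := by
    refine eq_zero_of_tensorRep_lmul (ρ := ρ) (fun b t => ?_) fun x => h2 x w
    have := tensorRep_map (ρ := ρ) (ρ' := ρ) (σ := Algebra.lmul k B)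
      (σ' := tensorRep (Algebra.lmul k B) (trivRep k B W)) (f := LinearMap.id)
      (g := (TensorProduct.mk k B W).flip w) (fun _ _ => rfl)
      (fun b c => by rw [tensorRep_trivRep]; rfl) b t
    simp only [LinearMap.comp_apply, q, this]
    exact hF b _
  exact LinearMap.congr_fun h3 (x ⊗ₜ b)

end Free

section Relative

universe u v w
variable {k : Type w} {B : Type v} {L : Type u} [Field k] [Ring B] [HopfAlgebra k B]
  [Ring L] [HopfAlgebra k L]

/-- The action of `B` on `L` through a homomorphism `B → L`. -/
def regRep (j : B →ₐc[k] L) : B →ₐ[k] End k L := (Algebra.lmul k L).comp (j : B →ₐ[k] L)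

@[simp] lemma regRep_apply (j : B →ₐc[k] L) (b : B) (x : L) : regRep j b x = j b * x := rfl

/-- The action of `B` on a `B`-stable subspace of `L`. -/
def subRep (j : B →ₐc[k] L) (V : Submodule k L) (hV : ∀ b, ∀ v ∈ V, j b * v ∈ V) :
    B →ₐ[k] End k V where
  toFun b := (regRep j b).restrict (hV b)
  map_one' := by ext; simp
  map_mul' a b := by
    ext v
    change j (a * b) * (v : L) = j a * (j b * v)
    rw [map_mul, mul_assoc]
  map_zero' := by ext; simp
  map_add' a b := by
    ext v
    change j (a + b) * (v : L) = j a * v + j b * v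
    rw [map_add, add_mul]
  commutes' r := by ext; simp [Algebra.smul_def]

@[simp] lemma coe_subRep (j : B →ₐc[k] L) (V : Submodule k L) (hV : ∀ b, ∀ v ∈ V, j b * v ∈ V)
    (b : B) (v : V) : (subRep j V hV b v : L) = j b * v := rfl

/-- The action of `B` on the quotient `L / B`. -/
def quotRep (j : B →ₐc[k] L) :
    B →ₐ[k] End k (L ⧸ LinearMap.range (j : B →ₐ[k] L).toLinearMap) where
  toFun b := Submodule.mapQ _ _ (regRep j b) (by rintro _ ⟨c, rfl⟩; exact ⟨b * c, by simp⟩)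
  map_one' := by ext; simp
  map_mul' a b := by ext; simp
  map_zero' := by ext; simp
  map_add' a b := by ext; simp
  commutes' r := by
    ext x
    simp only [AlgHom.commutes]
    rfl

lemma rTensor_subtype_injective (V : Submodule k L) (Y : Type*) [AddCommGroup Y] [Module k Y] :
    Function.Injective (V.subtype.rTensor Y) :=
  Module.Flat.rTensor_preserves_injective_linearMap _ V.injective_subtype

lemma subtype_tensorRep (j : B →ₐc[k] L) (V : Submodule k L) (hB : ∀ b, ∀ v ∈ V, j b * v ∈ V)
    (b : B) (t : V ⊗[k] L) :
    V.subtype.rTensor L (tensorRep (subRep j V hB) (regRep j) b t) =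
      comul (R := k) (j b) * V.subtype.rTensor L t := by
  have hj : comul (R := k) (j b) = TensorProduct.map (j : B →ₗ[k] L) (j : B →ₗ[k] L) (comul b) :=
    (CoalgHomClass.map_comp_comul_apply j b).symm
  rw [hj, tensorRep_repr _ _ (ℛ k b)]
  conv_rhs => rw [← (ℛ k b).eq]
  simp only [LinearMap.sum_apply, map_sum, Finset.sum_mul]
  refine Finset.sum_congr rfl fun i _ => ?_
  induction t with
  | zero => simp
  | add x y hx hy => simp only [map_add, hx, hy, mul_add]
  | tmul v l => simp

variable [FiniteDimensional k L]

/-- A comultiplication representation of an element of a right coideal. -/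
def reprOfBasis {ι : Type*} [Fintype ι] (e : Basis ι k L) (v : L) : Coalgebra.Repr k v ι where
  index := Finset.univ
  left i := contractRight (e.coord i) (comul v)
  right := e
  eq := sum_contractRight_tmul_basis e _

/-- The map `v ⊗ l ↦ v₁ ⊗ v₂ l` on a right coideal. -/
def coidealGalois (V : Submodule k L) (hV : ∀ v ∈ V, ∀ f : Dual k L, contractRight f
    (comul (R := k) v) ∈ V) :
    V ⊗[k] L →ₗ[k] V ⊗[k] L :=
  ∑ i, TensorProduct.map ((contractRight ((finBasis k L).coord i) ∘ₗ comul).restrict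
    (fun v hv => hV v hv _)) (LinearMap.mulLeft k (finBasis k L i))

lemma subtype_coidealGalois (V : Submodule k L)
    (hV : ∀ v ∈ V, ∀ f : Dual k L, contractRight f (comul (R := k) v) ∈ V) (v : V) (l : L) :
    V.subtype.rTensor L (coidealGalois V hV (v ⊗ₜ l)) = comul (R := k) (v : L) * (1 ⊗ₜ l) := by
  conv_rhs => rw [← (reprOfBasis (finBasis k L) (v : L)).eq]
  rw [Finset.sum_mul]
  simp [coidealGalois, LinearMap.sum_apply, reprOfBasis]

/-- The preimage of v ⊗ l is ∑ v₁ ⊗ S(v₂)l, which stays in V ⊗ L because V is a right coideal. -/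
lemma coidealGalois_surjective (V : Submodule k L)
    (hV : ∀ v ∈ V, ∀ f : Dual k L, contractRight f (comul (R := k) v) ∈ V) :
    Function.Surjective (coidealGalois V hV) := by
  intro t
  induction t with
  | zero => exact ⟨0, map_zero _⟩
  | add x y hx hy =>
    obtain ⟨a, rfl⟩ := hx; obtain ⟨b, rfl⟩ := hy
    exact ⟨a + b, map_add _ _ _⟩
  | tmul v l =>
    let R := reprOfBasis (finBasis k L) (v : L)
    refine ⟨∑ i ∈ R.index, (⟨R.left i, hV v v.2 _⟩ : V) ⊗ₜ (antipode k (R.right i) * l), ?_⟩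
    apply rTensor_subtype_injective
    rw [map_sum, map_sum]
    simp only [subtype_coidealGalois]
    have h := congr($(sum_comul_mul_antipode R) * (1 ⊗ₜ l))
    rw [Finset.sum_mul] at h
    simpa [mul_assoc] using h

/-- Δ(bv) = Δ(b)Δ(v). Hence V ⊗ L with the diagonal action amounts to dim L copies of V. -/
lemma coidealGalois_tensorRep (j : B →ₐc[k] L) (V : Submodule k L) (hB : ∀ b, ∀ v ∈ V, j b * v ∈ V)
    (hV : ∀ v ∈ V, ∀ f : Dual k L, contractRight f (comul (R := k) v) ∈ V)
    (b : B) (t : V ⊗[k] L) :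
    coidealGalois V hV (tensorRep (subRep j V hB) (trivRep k B L) b t) =
      tensorRep (subRep j V hB) (regRep j) b (coidealGalois V hV t) := by
  apply rTensor_subtype_injective
  rw [subtype_tensorRep, tensorRep_trivRep]
  induction t with
  | zero => simp
  | add x y hx hy => simp only [map_add, hx, hy, mul_add]
  | tmul v l =>
    rw [LinearMap.rTensor_tmul, subtype_coidealGalois, subtype_coidealGalois, coe_subRep,
      Bialgebra.comul_mul, mul_assoc]

/-- Through G⁻¹ the middle factor L becomes trivial, so V ⊗ L ⊗ W is dim L copies of V ⊗ W. -/
lemma finrank_mul_invDual_le (j : B →ₐc[k] L) {V : Type*} [AddCommGroup V] [Module k V]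
    [FiniteDimensional k V] (ρ : B →ₐ[k] End k V) (G : V ⊗[k] L →ₗ[k] V ⊗[k] L)
    (hs : Function.Surjective G)
    (hG : ∀ b t, G (tensorRep ρ (trivRep k B L) b t) = tensorRep ρ (regRep j) b (G t))
    {W : Type*} [AddCommGroup W] [Module k W] [FiniteDimensional k W] (σ : B →ₐ[k] End k W) :
    finrank k L * finrank k (invDual (tensorRep ρ σ)) ≤
      finrank k (invDual (tensorRep ρ (tensorRep (regRep j) σ))) := by
  let a : V ⊗[k] (L ⊗[k] W) →ₗ[k] (V ⊗[k] L) ⊗[k] W := (TensorProduct.assoc k V L W).symm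
  have ha : ∀ b t, a (tensorRep ρ (tensorRep (regRep j) σ) b t) =
      tensorRep (tensorRep ρ (regRep j)) σ b (a t) := by
    intro b t
    apply (TensorProduct.assoc k V L W).injective
    rw [tensorRep_assoc]
    simp [a]
  let e : V ⊗[k] L ≃ₗ[k] V ⊗[k] L := LinearEquiv.ofBijective G
    ⟨LinearMap.injective_iff_surjective.mpr hs, hs⟩
  let c : (V ⊗[k] L) ⊗[k] W →ₗ[k] (V ⊗[k] L) ⊗[k] W := TensorProduct.map e.symm.toLinearMap
      LinearMap.id
  have hc : ∀ b t, c (tensorRep (tensorRep ρ (regRep j)) σ b t) =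
      tensorRep (tensorRep ρ (trivRep k B L)) σ b (c t) :=
    tensorRep_map (ρ := tensorRep ρ (regRep j)) (ρ' := tensorRep ρ (trivRep k B L))
      (f := e.symm.toLinearMap) (g := LinearMap.id) (fun b t => by
      apply e.injective
      have := hG b (e.symm t)
      refine Eq.trans ?_ this.symm
      change e (e.symm _) = tensorRep _ _ _ (e (e.symm t))
      simp) (fun _ _ => rfl)
  let d : (V ⊗[k] L) ⊗[k] W →ₗ[k] (V ⊗[k] W) ⊗[k] L := TensorProduct.rightComm k V L W
  have hd : ∀ b t, d (tensorRep (tensorRep ρ (trivRep k B L)) σ b t) =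
      tensorRep (tensorRep ρ σ) (trivRep k B L) b (d t) := by
    intro b t
    rw [tensorRep_trivRep, tensorRep_repr _ _ (ℛ k b), tensorRep_repr _ _ (ℛ k b)]
    simp only [LinearMap.sum_apply, map_sum, tensorRep_trivRep]
    induction t with
    | zero => simp
    | add x y hx hy => simp only [map_add, Finset.sum_add_distrib, hx, hy]
    | tmul u w =>
      induction u with
      | zero => simp
      | add x y hx hy => simp only [map_add, add_tmul, Finset.sum_add_distrib, hx, hy]
      | tmul v l => simp [d, LinearMap.sum_apply, sum_tmul]
  refine (finrank_mul_finrank_invDual_le (Y := L) (tensorRep ρ σ)).trans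
    (finrank_invDual_le_of_surjective (X := V ⊗[k] (L ⊗[k] W))
      (Y := (V ⊗[k] W) ⊗[k] L) (ρ := tensorRep ρ (tensorRep (regRep j) σ))
      (σ := tensorRep (tensorRep ρ σ) (trivRep k B L)) (d ∘ₗ c ∘ₗ a) (fun b t => ?_) ?_)
  · simp only [LinearMap.comp_apply, ha, hc, hd]
  · have h1 : Function.Surjective a := (TensorProduct.assoc k V L W).symm.surjective
    have h2 : Function.Surjective c :=
      TensorProduct.map_surjective e.symm.surjective Function.surjective_id
    have h3 : Function.Surjective d := (TensorProduct.rightComm k V L W).surjective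
    exact h3.comp (h2.comp h1)

end Relative
end HopfAlgebra

/-! ### The Nichols–Zoeller type count and its consequences for coideals. -/

namespace HopfAlgebra

open Coalgebra WithConv TensorProduct Module

section NicholsZoeller

universe u v w
variable {k : Type w} {B : Type v} {L : Type u} [Field k] [Ring B] [HopfAlgebra k B]
  [Ring L] [HopfAlgebra k L] [FiniteDimensional k L] [FiniteDimensional k B]

/-- Filter the factor L of V ⊗ L ⊗ W by the image of B. The regular part contributes at most dim V ·
dim W invariants, which leaves the quotient L/B. -/
lemma finrank_mul_invDual_le_add (j : B →ₐc[k] L) {V : Type*}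
    [AddCommGroup V] [Module k V] [FiniteDimensional k V] (ρ : B →ₐ[k] End k V)
    (G : V ⊗[k] L →ₗ[k] V ⊗[k] L) (hs : Function.Surjective G)
    (hG : ∀ b t, G (tensorRep ρ (trivRep k B L) b t) = tensorRep ρ (regRep j) b (G t))
    {W : Type*} [AddCommGroup W] [Module k W] [FiniteDimensional k W] (σ : B →ₐ[k] End k W) :
    finrank k L * finrank k (invDual (tensorRep ρ σ)) ≤ finrank k V * finrank k W +
      finrank k (invDual (tensorRep ρ (tensorRep (quotRep j) σ))) := by
  refine (finrank_mul_invDual_le j ρ G hs hG σ).trans ?_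
  let j' : B →ₗ[k] L := (j : B →ₐ[k] L).toLinearMap
  let p := (LinearMap.range j').mkQ
  have hex : Function.Exact j' p := LinearMap.exact_map_mkQ_range j'
  have hex2 : Function.Exact (j'.rTensor W) (p.rTensor W) :=
    rTensor_exact W hex (Submodule.mkQ_surjective _)
  have hs2 : Function.Surjective (p.rTensor W) :=
    LinearMap.rTensor_surjective W (Submodule.mkQ_surjective _)
  have hex3 := lTensor_exact V hex2 hs2
  have hs3 : Function.Surjective ((p.rTensor W).lTensor V) := LinearMap.lTensor_surjective V hs2
  have hj1 : ∀ b t, j'.rTensor W (tensorRep (Algebra.lmul k B) σ b t) =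
      tensorRep (regRep j) σ b (j'.rTensor W t) :=
    tensorRep_map (ρ := Algebra.lmul k B) (ρ' := regRep j) (f := j') (g := LinearMap.id)
      (fun b x => map_mul j b x) fun _ _ => rfl
  have hp1 : ∀ b t, p.rTensor W (tensorRep (regRep j) σ b t) =
      tensorRep (quotRep j) σ b (p.rTensor W t) :=
    tensorRep_map (ρ := regRep j) (ρ' := quotRep j) (f := p) (g := LinearMap.id)
      (fun b x => rfl) fun _ _ => rfl
  refine (finrank_invDual_le_of_exact (σ := tensorRep ρ (tensorRep (Algebra.lmul k B) σ))
    ((j'.rTensor W).lTensor V) ((p.rTensor W).lTensor V)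
    (tensorRep_map (fun _ _ => rfl) hj1) (tensorRep_map (fun _ _ => rfl) hp1) hs3 hex3).trans ?_
  exact add_le_add (finrank_invDual_tensorRep_lmul_le _ _) le_rfl

/-- Let s be the supremum over nonzero W of dim inv(V ⊗ W) / dim W. Bounding the quotient term of
`finrank_mul_invDual_le_add` by s gives s·dim L ≤ dim V + s(dim L − dim B), that is, s·dim B ≤ dim
V. -/
lemma finrank_mul_finrank_invDual_tensorRep_le (j : B →ₐc[k] L) (hj : Function.Injective j)
    {V : Type*}
    [AddCommGroup V] [Module k V] [FiniteDimensional k V] (ρ : B →ₐ[k] End k V)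
    (G : V ⊗[k] L →ₗ[k] V ⊗[k] L) (hs : Function.Surjective G)
    (hG : ∀ b t, G (tensorRep ρ (trivRep k B L) b t) = tensorRep ρ (regRep j) b (G t))
    {W : Type u} [AddCommGroup W] [Module k W] [FiniteDimensional k W] (σ : B →ₐ[k] End k W) :
    finrank k B * finrank k (invDual (tensorRep ρ σ)) ≤
      finrank k V * finrank k W := by
  -- W ranges over the universe of L, so that the class is closed under W ↦ (L/B) ⊗ W.
  let S : Set ℝ := {r | ∃ (W : Type u) (_ : AddCommGroup W) (_ : Module k W)
    (_ : FiniteDimensional k W) (σ : B →ₐ[k] End k W), 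
    r * finrank k W = finrank k (invDual (tensorRep ρ σ)) ∧ 0 < finrank k W}
  have hle : ∀ (W : Type u) [AddCommGroup W] [Module k W] [FiniteDimensional k W]
      (σ : B →ₐ[k] End k W), finrank k (invDual (tensorRep ρ σ)) ≤
        finrank k V * finrank k W := by
    intro W _ _ _ σ
    refine (Submodule.finrank_le _).trans ?_
    rw [Subspace.dual_finrank_eq, finrank_tensorProduct]
  have hbdd : BddAbove S := by
    refine ⟨finrank k V, ?_⟩
    rintro r ⟨W, _, _, _, σ, h, h0⟩
    have h1 := hle W σ
    have h2 : (0 : ℝ) < finrank k W := by exact_mod_cast h0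
    refine le_of_mul_le_mul_right ?_ h2
    rw [h]
    exact_mod_cast h1
  have hmem : ∀ (W : Type u) [AddCommGroup W] [Module k W] [FiniteDimensional k W]
      (σ : B →ₐ[k] End k W), (finrank k (invDual (tensorRep ρ σ)) : ℝ) ≤
        sSup S * finrank k W := by
    intro W _ _ _ σ
    rcases Nat.eq_zero_or_pos (finrank k W) with h | h
    · have := hle W σ
      rw [h, mul_zero, Nat.le_zero] at this
      simp [this, h]
    · have h2 : (0 : ℝ) < finrank k W := by exact_mod_cast h
      rw [← div_le_iff₀ h2]
      exact le_csSup hbdd ⟨W, _, _, ‹_›, σ, by field_simp, h⟩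
  rcases Nat.eq_zero_or_pos (finrank k W) with h | h
  · have := hle W σ
    rw [h, mul_zero, Nat.le_zero] at this
    simp [this, h]
  have hne : S.Nonempty := by
    refine ⟨finrank k (invDual (tensorRep ρ σ)) / finrank k W, W, _, _, ‹_›, σ, ?_, h⟩
    have h2 : (finrank k W : ℝ) ≠ 0 := by exact_mod_cast h.ne'
    field_simp
  have hquot : (finrank k (L ⧸ LinearMap.range (j : B →ₐ[k] L).toLinearMap) : ℝ) =
      finrank k L - finrank k B := by
    have h1 := Submodule.finrank_quotient_add_finrank (LinearMap.range (j : B →ₐ[k] L).toLinearMap)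
    rw [LinearMap.finrank_range_of_inj (f := (j : B →ₐ[k] L).toLinearMap) hj] at h1
    rw [eq_sub_iff_add_eq]
    exact_mod_cast h1
  have hL : (0 : ℝ) < finrank k L ∨ finrank k L = 0 := by
    rcases Nat.eq_zero_or_pos (finrank k L) with h | h
    · exact .inr h
    · exact .inl (by exact_mod_cast h)
  have hLB : finrank k B ≤ finrank k L :=
    LinearMap.finrank_le_finrank_of_injective (f := (j : B →ₐ[k] L).toLinearMap) hj
  rcases hL with hL | hL
  swap
  · have : finrank k B = 0 := by omega
    simp [this]
  have key : finrank k L * sSup S ≤ finrank k V + sSup S * (finrank k L - finrank k B) := by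
    rw [mul_comm, ← le_div_iff₀ hL]
    refine csSup_le hne ?_
    rintro r ⟨W, _, _, _, σ, h, h0⟩
    have h2 : (0 : ℝ) < finrank k W := by exact_mod_cast h0
    have h3 : ((finrank k L : ℕ) : ℝ) * finrank k (invDual (tensorRep ρ σ)) ≤
        finrank k V * finrank k W +
        finrank k (invDual (tensorRep ρ (tensorRep (quotRep j) σ))) := by
      exact_mod_cast finrank_mul_invDual_le_add j ρ G hs hG σ
    have h4 := hmem _ (tensorRep (quotRep j) σ)
    rw [finrank_tensorProduct, Nat.cast_mul, hquot] at h4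
    rw [le_div_iff₀ hL]
    refine le_of_mul_le_mul_right ?_ h2
    rw [← h] at h3
    linarith
  have h5 := hmem W σ
  have h6 : (finrank k B : ℝ) * sSup S ≤ finrank k V := by linarith
  have h7 : (finrank k B : ℝ) * finrank k (invDual (tensorRep ρ σ)) ≤
      finrank k V * finrank k W :=
    calc _ ≤ (finrank k B : ℝ) * (sSup S * finrank k W) := by gcongr
      _ = (finrank k B * sSup S) * finrank k W := by ring
      _ ≤ _ := by gcongr
  exact_mod_cast h7

/-- The number of coinvariants of a right coideal stable under a Hopf subalgebra. -/
lemma finrank_mul_finrank_invDual_subRep_le (j : B →ₐc[k] L) (hj : Function.Injective j)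
    (V : Submodule k L)
    (hB : ∀ b, ∀ v ∈ V, j b * v ∈ V)
    (hV : ∀ v ∈ V, ∀ f : Dual k L, contractRight f (comul (R := k) v) ∈ V) :
    finrank k B * finrank k (invDual (subRep j V hB)) ≤ finrank k V := by
  -- The line spanned by 1 in L serves as the trivial module W in the required universe.
  have hcard : finrank k (k ∙ (1 : L)) ≤ 1 := by
    simpa using finrank_span_le_card (R := k) ({1} : Set L)
  let c : Dual k (k ∙ (1 : L)) := (counit (R := k)) ∘ₗ Submodule.subtype _
  have h1 := finrank_mul_finrank_invDual_tensorRep_le j hj (subRep j V hB)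
    (coidealGalois V hV) (coidealGalois_surjective V hV) (coidealGalois_tensorRep j V hB hV)
        (trivRep k B (k ∙ (1 : L)))
  have h2 := finrank_invDual_le_of_surjective (σ := subRep j V hB)
    (ρ := tensorRep (subRep j V hB) (trivRep k B (k ∙ (1 : L)))) (contractRight c) (fun b t => by
      rw [tensorRep_trivRep]
      induction t with
      | zero => simp
      | add x y hx hy => simp only [map_add, hx, hy]
      | tmul x y => simp) (fun v => ⟨v ⊗ₜ ⟨1, Submodule.mem_span_singleton_self _⟩, by simp [c]⟩)
  calc _ ≤ _ := Nat.mul_le_mul_left _ h2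
    _ ≤ _ := h1
    _ ≤ finrank k V * 1 := Nat.mul_le_mul_left _ hcard
    _ = _ := mul_one _

/-- A right coideal containing `1` with at most one coinvariant lies in the Hopf subalgebra. -/
lemma le_range_of_finrank_invDual_le_one (j : B →ₐc[k] L) (hj : Function.Injective j)
    (V : Submodule k L) (hB : ∀ b, ∀ v ∈ V, j b * v ∈ V)
    (hV : ∀ v ∈ V, ∀ f : Dual k L, contractRight f (comul (R := k) v) ∈ V) (h1 : (1 : L) ∈ V)
    (hle : finrank k (invDual (subRep j V hB)) ≤ 1) (v : L) (hv : v ∈ V) : ∃ b, j b = v := by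
  rcases subsingleton_or_nontrivial L with hL | hL
  · exact ⟨0, Subsingleton.elim _ _⟩
  have hnt : Nontrivial B := by
    refine ⟨0, 1, fun h => zero_ne_one (α := L) ?_⟩
    rw [← map_zero j, h, map_one]
  obtain ⟨r, f, hr, hf⟩ := exists_right_integral (k := k) (B := B)
  have hcounit : ∀ b, counit (R := k) (j b) = counit (R := k) b := fun b =>
    CoalgHomClass.counit_comp_apply j b
  let ε : invDual (subRep j V hB) := ⟨(counit (R := k)) ∘ₗ V.subtype, fun b x => by simp [hcounit]⟩
  have hε : ε ≠ 0 := by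
    intro h
    have := LinearMap.congr_fun (congrArg Subtype.val h) ⟨1, h1⟩
    simp [ε] at this
  -- As r is a right integral of B, v ↦ φ(rv) is invariant for every functional φ, hence a multiple
  -- of ε; its value at v = 1 gives the factor φ(r).
  have hrv : ∀ v ∈ V, j r * v = counit (R := k) v • j r := by
    intro v hv
    by_contra hne
    rw [← sub_eq_zero] at hne
    obtain ⟨φ, hφ⟩ := Module.Projective.exists_dual_ne_zero k hne
    let F : invDual (subRep j V hB) := ⟨φ ∘ₗ LinearMap.mulLeft k (j r) ∘ₗ V.subtype, fun b x => by
      simp [← mul_assoc, ← map_mul, hr]⟩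
    have hone : finrank k (invDual (subRep j V hB)) = 1 := by
      refine le_antisymm hle (Nat.one_le_iff_ne_zero.mpr fun h0 => hε ?_)
      have := Module.Free.of_divisionRing k (invDual (subRep j V hB))
      exact @Subsingleton.elim _ (Module.finrank_zero_iff.mp h0) _ _
    obtain ⟨c, hc⟩ := exists_smul_eq_of_finrank_eq_one hone hε F
    have h2 (x : V) : φ (j r * x) = c * counit (R := k) (x : L) :=
      (LinearMap.congr_fun (congrArg Subtype.val hc) x).symm
    have h3 := h2 ⟨1, h1⟩
    have h4 := h2 ⟨v, hv⟩
    simp only [mul_one, Bialgebra.counit_one] at h3 h4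
    apply hφ
    rw [map_sub, map_smul, h4, h3, smul_eq_mul, mul_comm, sub_self]
  obtain ⟨g, hg⟩ := LinearMap.exists_leftInverse_of_injective (j : B →ₐ[k] L).toLinearMap
    (LinearMap.ker_eq_bot.mpr hj)
  -- In Δ(r)(v ⊗ 1) = Δ(r)(1 ⊗ S(v)), contract the second leg by f ∘ g with g a linear retraction of
  -- `j`: the left side becomes v, while the first legs on the right lie in B.
  have hcm := comul_mul_tmul_one_of_integral (k := k) (r := j r) (v := v)
    (reprOfBasis (finBasis k L) v) (fun i _ => hrv _ (hV v hv _))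
  have hj2 : comul (R := k) (j r) = TensorProduct.map (j : B →ₗ[k] L) (j : B →ₗ[k] L) (comul r) :=
    (CoalgHomClass.map_comp_comul_apply j r).symm
  have hgj : ∀ b, g (j b) = b := fun b => LinearMap.congr_fun hg b
  have hl : ∀ s : B ⊗[k] B, contractRight (f ∘ₗ g)
      (TensorProduct.map (j : B →ₗ[k] L) (j : B →ₗ[k] L) s * (v ⊗ₜ 1)) = j (contractRight f s) * v
          := by
    intro s
    induction s with
    | zero => simp
    | add x y hx hy => simp only [map_add, add_mul, hx, hy]
    | tmul x y => simp [hgj]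
  have hr2 : ∀ s : B ⊗[k] B, ∃ b, j b = contractRight (f ∘ₗ g)
      (TensorProduct.map (j : B →ₗ[k] L) (j : B →ₗ[k] L) s * (1 ⊗ₜ antipode k v)) := by
    intro s
    induction s with
    | zero => exact ⟨0, by simp⟩
    | add x y hx hy =>
      obtain ⟨a, ha⟩ := hx
      obtain ⟨b, hb⟩ := hy
      exact ⟨a + b, by simp only [map_add, add_mul, ha, hb]⟩
    | tmul x y => exact ⟨f (g (j y * antipode k v)) • x, by simp⟩
  obtain ⟨b, hb⟩ := hr2 (comul r)
  refine ⟨b, ?_⟩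
  rw [hb, ← hj2, ← hcm, hj2, hl, hf, map_one, one_mul]

/-- A right coideal of dimension less than `2 dim B` lies in the Hopf subalgebra `B`. -/
lemma le_range_of_finrank_lt (j : B →ₐc[k] L) (hj : Function.Injective j)
    (V : Submodule k L) (hB : ∀ b, ∀ v ∈ V, j b * v ∈ V)
    (hV : ∀ v ∈ V, ∀ f : Dual k L, contractRight f (comul (R := k) v) ∈ V) (h1 : (1 : L) ∈ V)
    (hlt : finrank k V < 2 * finrank k B) (v : L) (hv : v ∈ V) : ∃ b, j b = v := by
  refine le_range_of_finrank_invDual_le_one j hj V hB hV h1 ?_ v hv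
  by_contra! h
  have h2 := finrank_mul_finrank_invDual_subRep_le j hj V hB hV
  have h3 := Nat.mul_le_mul_left (finrank k B) h
  omega

end NicholsZoeller
end HopfAlgebra

/-! ### The dual Hopf algebra and transposes of homomorphisms. -/

/-- The linear dual of a Hopf algebra with the convolution product. -/
def HopfDual (k H : Type*) [Field k] [Ring H] [HopfAlgebra k H] := WithConv (H →ₗ[k] k)

namespace HopfDual

open Coalgebra TensorProduct Module

variable {k H : Type*} [Field k] [Ring H] [HopfAlgebra k H]

instance : Ring (HopfDual k H) := inferInstanceAs (Ring (WithConv (H →ₗ[k] k)))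

instance : Algebra k (HopfDual k H) := inferInstanceAs (Algebra k (WithConv (H →ₗ[k] k)))

variable (k H) in
/-- The underlying functional of an element of the dual Hopf algebra. -/
def toDual : HopfDual k H ≃ₗ[k] Dual k H where
  toFun := WithConv.ofConv
  invFun := WithConv.toConv
  left_inv _ := rfl
  right_inv _ := rfl
  map_add' _ _ := rfl
  map_smul' _ _ := rfl

@[ext] lemma ext {f g : HopfDual k H} (h : ∀ x, toDual k H f x = toDual k H g x) : f = g :=
  (toDual k H).injective (LinearMap.ext h)

lemma mul_apply_repr {a : H} {ι : Type*} (r : Coalgebra.Repr k a ι) (f g : HopfDual k H) :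
    toDual k H (f * g) a = ∑ i ∈ r.index, toDual k H f (r.left i) * toDual k H g (r.right i) :=
        r.convMul_apply _ _

@[simp] lemma one_apply (a : H) : toDual k H 1 a = counit (R := k) a := rfl

lemma finrank_eq : finrank k (HopfDual k H) = finrank k H :=
  (toDual k H).finrank_eq.trans Subspace.dual_finrank_eq

variable [FiniteDimensional k H]

instance : FiniteDimensional k (HopfDual k H) :=
  Module.Finite.equiv (toDual k H).symm

/-- The evaluation isomorphism `H* ⊗ H* ≃ (H ⊗ H)*`. -/
def evalEquiv₂ : HopfDual k H ⊗[k] HopfDual k H ≃ₗ[k] Dual k (H ⊗[k] H) :=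
  (TensorProduct.congr (toDual k H) (toDual k H)).trans
    (TensorProduct.dualDistribEquiv k H H)

@[simp] lemma evalEquiv₂_tmul (f g : HopfDual k H) (x y : H) :
    evalEquiv₂ (f ⊗ₜ[k] g) (x ⊗ₜ y) = toDual k H f x * toDual k H g y := by
  simp [evalEquiv₂, TensorProduct.dualDistribEquiv, TensorProduct.dualDistribEquivOfBasis]

/-- The evaluation isomorphism `H* ⊗ (H* ⊗ H*) ≃ (H ⊗ (H ⊗ H))*`. -/
def evalEquiv₃ : HopfDual k H ⊗[k] (HopfDual k H ⊗[k] HopfDual k H) ≃ₗ[k] Dual k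
    (H ⊗[k] (H ⊗[k] H)) :=
  (TensorProduct.congr (toDual k H) evalEquiv₂).trans
    (TensorProduct.dualDistribEquiv k H (H ⊗[k] H))

@[simp] lemma evalEquiv₃_tmul (f : HopfDual k H) (t : HopfDual k H ⊗[k] HopfDual k H) (x : H)
    (y : H ⊗[k] H) : evalEquiv₃ (f ⊗ₜ[k] t) (x ⊗ₜ y) = toDual k H f x * evalEquiv₂ t y := by
  simp [evalEquiv₃, TensorProduct.dualDistribEquiv, TensorProduct.dualDistribEquivOfBasis]

lemma ext_evalEquiv₂ {s t : HopfDual k H ⊗[k] HopfDual k H}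
    (h : ∀ x y, evalEquiv₂ s (x ⊗ₜ y) = evalEquiv₂ t (x ⊗ₜ y)) : s = t := by
  apply evalEquiv₂.injective
  ext x y
  exact h x y

instance : CoalgebraStruct k (HopfDual k H) where
  comul := evalEquiv₂.symm.toLinearMap ∘ₗ (LinearMap.mul' k H).dualMap ∘ₗ
    (toDual k H).toLinearMap
  counit := Dual.eval k H 1 ∘ₗ (toDual k H).toLinearMap

@[simp] lemma evalEquiv₂_comul (f : HopfDual k H) (x y : H) :
    evalEquiv₂ (comul (R := k) f) (x ⊗ₜ y) = toDual k H f (x * y) := by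
  simp [comul]

@[simp] lemma counit_apply (f : HopfDual k H) : counit (R := k) f = toDual k H f 1 := rfl

instance : Coalgebra k (HopfDual k H) where
  coassoc := by
    ext1 f
    apply evalEquiv₃.injective
    ext x y z
    have h1 : ∀ t : HopfDual k H ⊗[k] HopfDual k H,
        evalEquiv₃ (TensorProduct.assoc k _ _ _ ((comul (R := k)).rTensor _ t)) (x ⊗ₜ (y ⊗ₜ z)) =
          evalEquiv₂ t ((x * y) ⊗ₜ z) := by
      intro t
      induction t with
      | zero => simp
      | add x y hx hy => simp only [map_add, LinearMap.add_apply, hx, hy]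
      | tmul f g =>
        rw [LinearMap.rTensor_tmul, evalEquiv₂_tmul, ← evalEquiv₂_comul]
        generalize comul (R := k) f = s
        induction s with
        | zero => simp
        | add x y hx hy => simp only [map_add, add_tmul, LinearMap.add_apply, hx, hy, add_mul]
        | tmul a b => simp [mul_assoc]
    have h2 : ∀ t : HopfDual k H ⊗[k] HopfDual k H,
        evalEquiv₃ ((comul (R := k)).lTensor _ t) (x ⊗ₜ (y ⊗ₜ z)) =
          evalEquiv₂ t (x ⊗ₜ (y * z)) := by
      intro t
      induction t with
      | zero => simp
      | add x y hx hy => simp only [map_add, LinearMap.add_apply, hx, hy]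
      | tmul f g => simp
    refine (h1 (comul f)).trans (Eq.trans ?_ (h2 (comul f)).symm)
    simp [mul_assoc]
  rTensor_counit_comp_comul := by
    ext1 f
    apply (TensorProduct.lid k _).injective
    ext y
    have h1 : ∀ t : HopfDual k H ⊗[k] HopfDual k H,
        toDual k H (TensorProduct.lid k _ ((counit (R := k)).rTensor _ t)) y = evalEquiv₂ t
            (1 ⊗ₜ y) := by
      intro t
      induction t with
      | zero => simp
      | add x y hx hy => simp only [map_add, LinearMap.add_apply, hx, hy]
      | tmul f g => simp
    refine (h1 (comul f)).trans ?_
    simp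
  lTensor_counit_comp_comul := by
    ext1 f
    apply (TensorProduct.rid k _).injective
    ext y
    have h1 : ∀ t : HopfDual k H ⊗[k] HopfDual k H,
        toDual k H (TensorProduct.rid k _ ((counit (R := k)).lTensor _ t)) y = evalEquiv₂ t
            (y ⊗ₜ 1) := by
      intro t
      induction t with
      | zero => simp
      | add x y hx hy => simp only [map_add, LinearMap.add_apply, hx, hy]
      | tmul f g => simp [mul_comm]
    refine (h1 (comul f)).trans ?_
    simp

lemma evalEquiv₂_mul (s t : HopfDual k H ⊗[k] HopfDual k H) {x y : H} {ι κ : Type*}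
    (r : Coalgebra.Repr k x ι) (r' : Coalgebra.Repr k y κ) :
    evalEquiv₂ (s * t) (x ⊗ₜ y) = ∑ i ∈ r.index, ∑ j ∈ r'.index,
      evalEquiv₂ s (r.left i ⊗ₜ r'.left j) * evalEquiv₂ t (r.right i ⊗ₜ r'.right j) := by
  induction s with
  | zero => simp
  | add a b ha hb =>
    simp only [add_mul, map_add, LinearMap.add_apply, ha, hb, Finset.sum_add_distrib]
  | tmul f f' =>
    induction t with
    | zero => simp
    | add a b ha hb =>
      simp only [mul_add, map_add, LinearMap.add_apply, ha, hb, Finset.sum_add_distrib]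
    | tmul g g' =>
      simp only [Algebra.TensorProduct.tmul_mul_tmul, evalEquiv₂_tmul, mul_apply_repr r,
        mul_apply_repr r', Finset.sum_mul_sum]
      refine Finset.sum_congr rfl fun i _ => Finset.sum_congr rfl fun j _ => by ring

instance : Bialgebra k (HopfDual k H) := Bialgebra.mk' k (HopfDual k H)
  (by simp)
  (fun {f g} => by
    let r : Coalgebra.Repr k (1 : H) Unit :=
      { index := {()}, left := fun _ => 1, right := fun _ => 1,
        eq := by simp [Algebra.TensorProduct.one_def] }
    simp [mul_apply_repr r, r])
  (ext_evalEquiv₂ fun x y => by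
    simp [Algebra.TensorProduct.one_def])
  (fun {f g} => ext_evalEquiv₂ fun x y => by
    rw [evalEquiv₂_mul _ _ (ℛ k x) (ℛ k y), evalEquiv₂_comul, mul_apply_repr ((ℛ k x).mul (ℛ k y))]
    simp [Finset.sum_product])

instance : HopfAlgebra k (HopfDual k H) where
  antipode := (toDual k H).symm.toLinearMap ∘ₗ
    (HopfAlgebra.antipode k (A := H)).dualMap ∘ₗ (toDual k H).toLinearMap
  mul_antipode_rTensor_comul := by
    ext f x
    have h1 : ∀ t : HopfDual k H ⊗[k] HopfDual k H,
        toDual k H (LinearMap.mul' k _ (((toDual k H).symm.toLinearMap ∘ₗ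
          (HopfAlgebra.antipode k (A := H)).dualMap ∘ₗ (toDual k H).toLinearMap).rTensor _ t)) x =
        evalEquiv₂ t (∑ i ∈ (ℛ k x).index,
          HopfAlgebra.antipode k ((ℛ k x).left i) ⊗ₜ (ℛ k x).right i) := by
      intro t
      induction t with
      | zero => simp
      | add x y hx hy => simp only [map_add, LinearMap.add_apply, hx, hy]
      | tmul f g => simp [mul_apply_repr (ℛ k x)]
    refine (h1 (comul f)).trans ?_
    rw [map_sum]
    simp only [evalEquiv₂_comul, ← map_sum, HopfAlgebra.sum_antipode_mul_eq_smul]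
    simp [Algebra.algebraMap_eq_smul_one, mul_comm]
  mul_antipode_lTensor_comul := by
    ext f x
    have h1 : ∀ t : HopfDual k H ⊗[k] HopfDual k H,
        toDual k H (LinearMap.mul' k _ (((toDual k H).symm.toLinearMap ∘ₗ
          (HopfAlgebra.antipode k (A := H)).dualMap ∘ₗ (toDual k H).toLinearMap).lTensor _ t)) x =
        evalEquiv₂ t (∑ i ∈ (ℛ k x).index,
          (ℛ k x).left i ⊗ₜ HopfAlgebra.antipode k ((ℛ k x).right i)) := by
      intro t
      induction t with
      | zero => simp
      | add x y hx hy => simp only [map_add, LinearMap.add_apply, hx, hy]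
      | tmul f g => simp [mul_apply_repr (ℛ k x)]
    refine (h1 (comul f)).trans ?_
    rw [map_sum]
    simp only [evalEquiv₂_comul, ← map_sum, HopfAlgebra.sum_mul_antipode_eq_smul]
    simp [Algebra.algebraMap_eq_smul_one, mul_comm]

end HopfDual

namespace HopfDual

open Coalgebra TensorProduct Module HopfAlgebra

variable {k H A : Type*} [Field k] [Ring H] [HopfAlgebra k H] [Ring A] [HopfAlgebra k A]

/-- Both S ∘ π and π ∘ S are convolution inverses of π. -/
lemma map_antipode (π : H →ₐc[k] A) (h : H) : π (antipode k h) = antipode k (π h) := by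
  have h1 : WithConv.toConv (antipode k ∘ₗ (π : H →ₐ[k] A).toLinearMap) *
      WithConv.toConv (π : H →ₐ[k] A).toLinearMap = 1 := by
    have := LinearMap.convMul_comp_coalgHom_distrib (WithConv.toConv (antipode k (A := A)))
      (WithConv.toConv LinearMap.id) (π : H →ₗc[k] A)
    rw [LinearMap.antipode_mul_id] at this
    apply WithConv.ext
    refine this.symm.trans ?_
    ext x; simp [LinearMap.convOne_def]
  exact (congr($(left_inv_eq_right_inv h1 (algHom_conv_antipode (π : H →ₐ[k] A))) h)).symm

variable [FiniteDimensional k H] [FiniteDimensional k A]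

/-- The transpose of a homomorphism of Hopf algebras. -/
def map (π : H →ₐc[k] A) : HopfDual k A →ₐc[k] HopfDual k H :=
  BialgHom.ofAlgHom
    (AlgHom.ofLinearMap ((toDual k H).symm.toLinearMap ∘ₗ (π : H →ₗ[k] A).dualMap ∘ₗ
        (toDual k A).toLinearMap)
      (by ext x; simp)
      (fun f g => by
        ext x
        have h := mul_apply_repr ((ℛ k x).induced (π : H →ₗc[k] A)) f g
        simp only [LinearMap.comp_apply, LinearEquiv.coe_coe, LinearEquiv.apply_symm_apply,
          mul_apply_repr (ℛ k x)]
        exact h))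
    (by ext f; simp)
    (by
      ext f
      apply ext_evalEquiv₂
      intro x y
      have h : ∀ t : HopfDual k A ⊗[k] HopfDual k A, evalEquiv₂ (TensorProduct.map
          ((toDual k H).symm.toLinearMap ∘ₗ (π : H →ₗ[k] A).dualMap ∘ₗ (toDual k A).toLinearMap)
          ((toDual k H).symm.toLinearMap ∘ₗ (π : H →ₗ[k] A).dualMap ∘ₗ (toDual k A).toLinearMap) t)
          (x ⊗ₜ y) = evalEquiv₂ t (π x ⊗ₜ π y) := by
        intro t
        induction t with
        | zero => simp
        | add x y hx hy => simp only [map_add, LinearMap.add_apply, hx, hy]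
        | tmul f g => simp
      refine (h (comul f)).trans ?_
      simp)

@[simp] lemma toDual_map (π : H →ₐc[k] A) (f : HopfDual k A) (x : H) :
    toDual k H (map π f) x = toDual k A f (π x) := rfl

lemma map_injective (π : H →ₐc[k] A) (hπ : Function.Surjective π) :
    Function.Injective (map π) := fun f g h => by
  ext x
  obtain ⟨x, rfl⟩ := hπ x
  rw [← toDual_map, h, toDual_map]

lemma map_surjective (π : H →ₐc[k] A) (hπ : Function.Injective π) :
    Function.Surjective (map π) := fun f => by
  obtain ⟨g, hg⟩ := LinearMap.exists_leftInverse_of_injective (π : H →ₐ[k] A).toLinearMap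
    (LinearMap.ker_eq_bot.mpr hπ)
  refine ⟨(toDual k A).symm (toDual k H f ∘ₗ g), ?_⟩
  ext x
  have : g (π x) = x := LinearMap.congr_fun hg x
  simp [this]

lemma exists_eval (F : Dual k (HopfDual k H)) : ∃ y : H, ∀ f, F f = toDual k H f y := by
  obtain ⟨y, hy⟩ := (Module.evalEquiv k H).surjective (F ∘ₗ (toDual k H).symm.toLinearMap)
  refine ⟨y, fun f => ?_⟩
  simpa using (LinearMap.congr_fun hy (toDual k H f)).symm

/-- Every functional on H* is evaluation at some y, so right coideals of H* are the subspaces closed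
under f ↦ f(· y). -/
lemma toDual_contractRight_comul (F : Dual k (HopfDual k H)) (y : H)
    (hF : ∀ f, F f = toDual k H f y) (f : HopfDual k H) (x : H) :
    toDual k H (contractRight F (comul (R := k) f)) x = toDual k H f (x * y) := by
  rw [← evalEquiv₂_comul]
  generalize comul (R := k) f = t
  induction t with
  | zero => simp
  | add x y hx hy => simp only [map_add, LinearMap.add_apply, hx, hy]
  | tmul f g => simp [hF, mul_comm]

/-- The action of A* on H* is the transpose of the contraction that defines left coinvariants. -/
lemma toDual_map_mul (π : H →ₐc[k] A) (b : HopfDual k A) (f : HopfDual k H) (x : H) :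
    toDual k H (map π b * f) x =
      toDual k H f (contractLeft (toDual k A b ∘ₗ (π : H →ₗ[k] A)) (comul (R := k) x)) := by
  rw [mul_apply_repr (ℛ k x)]
  conv_rhs => rw [← (ℛ k x).eq]
  simp

end HopfDual

/-! ### The dimension of the coinvariants. -/

namespace HopfAlgebra

open Coalgebra TensorProduct Module HopfDual

variable {k H A : Type*} [Field k] [Ring H] [HopfAlgebra k H] [Ring A] [HopfAlgebra k A]

/-- The left coinvariants of a homomorphism of Hopf algebras. -/
def leftCoinvariants (π : H →ₐc[k] A) : Submodule k H where
  carrier := {h | ∀ b : Dual k A, contractLeft (b ∘ₗ (π : H →ₗ[k] A)) (comul (R := k) h) = b 1 • h}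
  add_mem' h₁ h₂ b := by rw [map_add, map_add, h₁ b, h₂ b, smul_add]
  zero_mem' b := by simp
  smul_mem' c h hh b := by rw [map_smul, map_smul, hh b, smul_comm]

lemma mem_coinvariants_iff [FiniteDimensional k A] (π : H →ₐc[k] A) (h : H) : h ∈ coinvariants π ↔
    ∀ b : Dual k A, contractRight (b ∘ₗ (π : H →ₗ[k] A)) (comul (R := k) h) = b 1 • h := by
  have h1 : ∀ (b : Dual k A) (t : H ⊗[k] H), contractRight (b ∘ₗ (π : H →ₗ[k] A)) t =
      contractRight b (Algebra.TensorProduct.map (AlgHom.id k H) (π : H →ₐ[k] A) t) := by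
    intro b t
    induction t with
    | zero => simp
    | add x y hx hy => simp only [map_add, hx, hy]
    | tmul x y => simp
  simp only [h1]
  constructor
  · intro hh b
    have : Algebra.TensorProduct.map (AlgHom.id k H) (π : H →ₐ[k] A) (comul h) = h ⊗ₜ 1 := hh
    rw [this, contractRight_tmul]
  · intro hh
    refine tensor_ext_contractRight fun b => (hh b).trans ?_
    simp

variable [FiniteDimensional k A]

lemma antipode_mem_coinvariants (π : H →ₐc[k] A) {h : H} (hh : h ∈ leftCoinvariants π) :
    antipode k h ∈ coinvariants π := by
  rw [mem_coinvariants_iff]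
  intro b
  have := congr(antipode k $(hh (b ∘ₗ antipode k)))
  simp only [map_smul, LinearMap.comp_apply, antipode_one] at this
  rw [← this, comul_antipode]
  generalize comul (R := k) h = t
  induction t with
  | zero => simp
  | add x y hx hy => simp only [map_add, hx, hy]
  | tmul x y => simp [map_antipode]

lemma antipode_mem_leftCoinvariants (π : H →ₐc[k] A) {h : H} (hh : h ∈ coinvariants π) :
    antipode k h ∈ leftCoinvariants π := by
  rw [mem_coinvariants_iff] at hh
  intro b
  have := congr(antipode k $(hh (b ∘ₗ antipode k)))
  simp only [map_smul, LinearMap.comp_apply, antipode_one] at this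
  rw [← this, comul_antipode]
  generalize comul (R := k) h = t
  induction t with
  | zero => simp
  | add x y hx hy => simp only [map_add, hx, hy]
  | tmul x y => simp [map_antipode]

variable [FiniteDimensional k H]

/-- The antipode reverses Δ and commutes with π, so it embeds each space of coinvariants into the
other. -/
lemma finrank_coinvariants_eq (π : H →ₐc[k] A) :
    finrank k (coinvariants π) = finrank k (leftCoinvariants π) := by
  apply le_antisymm
  · exact LinearMap.finrank_le_finrank_of_injective
      (f := (antipode k).restrict (p := Subalgebra.toSubmodule (coinvariants π))
        (q := leftCoinvariants π) fun _ => antipode_mem_leftCoinvariants π)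
      fun x y h => Subtype.ext (antipode_bijective.1 (congrArg Subtype.val h))
  · exact LinearMap.finrank_le_finrank_of_injective
      (f := (antipode k).restrict (q := Subalgebra.toSubmodule (coinvariants π))
        (p := leftCoinvariants π) fun _ => antipode_mem_coinvariants π)
      fun x y h => Subtype.ext (antipode_bijective.1 (congrArg Subtype.val h))

lemma eval_mem_invDual_iff (π : H →ₐc[k] A) (h : H) (F : Dual k (⊤ : Submodule k (HopfDual k H)))
    (hF : ∀ f, F f = toDual k H f h) :
    F ∈ invDual (subRep (HopfDual.map π) ⊤ fun _ _ _ => Submodule.mem_top) ↔ h ∈ leftCoinvariants π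
        := by
  rw [mem_invDual]
  have h1 : ∀ b (f : (⊤ : Submodule k (HopfDual k H))),
    F (subRep (HopfDual.map π) ⊤ (fun _ _ _ => Submodule.mem_top) b f) = toDual k H f
      (contractLeft (toDual k A b ∘ₗ (π : H →ₗ[k] A)) (comul (R := k) h)) := by
    intro b f
    rw [hF, coe_subRep, toDual_map_mul]
  simp only [h1, hF]
  constructor
  · intro hh b
    rw [← sub_eq_zero]
    by_contra hne
    obtain ⟨φ, hφ⟩ := Module.Projective.exists_dual_ne_zero k hne
    have := hh ((toDual k A).symm b) ⟨(toDual k H).symm φ, Submodule.mem_top⟩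
    simp at this
    exact hφ (by simp [this])
  · intro hh b f
    rw [hh]
    simp

/-- Left coinvariants are the A*-invariant functionals on H*. The count for V = H* over A* bounds
their number by 2, and with at most one of them H* would lie in the image of A*. -/
lemma finrank_leftCoinvariants (π : H →ₐc[k] A) (hπ : Function.Surjective π)
    (hdim : finrank k H = 2 * finrank k A) (hA : 0 < finrank k A) :
    finrank k (leftCoinvariants π) = 2 := by
  let ρ := subRep (HopfDual.map π) ⊤ fun _ _ _ => Submodule.mem_top
  let g : leftCoinvariants π →ₗ[k] invDual ρ := LinearMap.codRestrict _
    ((LinearMap.lcomp k k ((toDual k H).toLinearMap ∘ₗ (⊤ : Submodule k (HopfDual k H)).subtype)) ∘ₗ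
      Dual.eval k H ∘ₗ Submodule.subtype _)
    fun h => (eval_mem_invDual_iff π h _ fun f => rfl).mpr h.2
  have hg : Function.Bijective g := by
    constructor
    · rw [injective_iff_map_eq_zero]
      intro h hh
      by_contra hne
      have hne2 : (h : H) ≠ 0 := fun h0 => hne (Subtype.ext h0)
      obtain ⟨φ, hφ⟩ := Module.Projective.exists_dual_ne_zero k hne2
      have := LinearMap.congr_fun (congrArg Subtype.val hh) ⟨(toDual k H).symm φ, Submodule.mem_top⟩
      apply hφ
      simpa using! this
    · rintro ⟨F, hF⟩
      obtain ⟨y, hy⟩ := exists_eval (F ∘ₗ (LinearEquiv.ofTop (⊤ : Submodule k (HopfDual k H))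
          rfl).symm.toLinearMap)
      have hy' : ∀ f, F f = toDual k H f y := fun f => hy f
      refine ⟨⟨y, (eval_mem_invDual_iff π y F hy').mp hF⟩, ?_⟩
      ext f
      exact (hy' f).symm
  rw [(LinearEquiv.ofBijective g hg).finrank_eq]
  have hj := HopfDual.map_injective π hπ
  apply le_antisymm
  · have := finrank_mul_finrank_invDual_subRep_le (HopfDual.map π) hj ⊤
      (fun _ _ _ => Submodule.mem_top)
      (fun _ _ _ => Submodule.mem_top)
    rw [finrank_top, HopfDual.finrank_eq, HopfDual.finrank_eq, hdim, mul_comm 2] at this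
    exact le_of_mul_le_mul_left this hA
  · by_contra! hlt
    have h1 := le_range_of_finrank_invDual_le_one (HopfDual.map π) hj ⊤
        (fun _ _ _ => Submodule.mem_top)
      (fun _ _ _ => Submodule.mem_top) Submodule.mem_top (Nat.le_of_lt_succ hlt)
    have h2 := LinearMap.finrank_le_finrank_of_surjective
      (f := (HopfDual.map π : HopfDual k A →ₐ[k] HopfDual k H).toLinearMap) fun v => h1 v
          Submodule.mem_top
    rw [HopfDual.finrank_eq, HopfDual.finrank_eq] at h2
    omega

lemma finrank_coinvariants (π : H →ₐc[k] A) (hπ : Function.Surjective π)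
    (hdim : finrank k H = 2 * finrank k A) (hA : 0 < finrank k A) :
    finrank k (coinvariants π) = 2 := by
  rw [finrank_coinvariants_eq, finrank_leftCoinvariants π hπ hdim hA]

end HopfAlgebra

/-! ### Translations by characters and the adjoint action. -/

namespace HopfAlgebra

open Coalgebra WithConv TensorProduct Module HopfSubalgebra

section Contract

variable {k M N P : Type*} [Field k] [AddCommGroup M] [Module k M] [AddCommGroup N] [Module k N]
  [AddCommGroup P] [Module k P]

lemma map_contractLeft (φ : N →ₗ[k] P) (f : Dual k M) (t : M ⊗[k] N) :
    φ (contractLeft f t) = contractLeft f (φ.lTensor M t) := by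
  induction t with
  | zero => simp
  | add x y hx hy => simp only [map_add, hx, hy]
  | tmul x y => simp

lemma map_contractRight (φ : M →ₗ[k] P) (f : Dual k N) (t : M ⊗[k] N) :
    φ (contractRight f t) = contractRight f (φ.rTensor N t) := by
  induction t with
  | zero => simp
  | add x y hx hy => simp only [map_add, hx, hy]
  | tmul x y => simp

lemma apply_contractLeft (f : Dual k M) (g : Dual k N) (t : M ⊗[k] N) :
    g (contractLeft f t) = f (contractRight g t) := by
  induction t with
  | zero => simp
  | add x y hx hy => simp only [map_add, hx, hy]
  | tmul x y => simp [mul_comm]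

lemma contractLeft_rTensor (φ : M →ₗ[k] P) (f : Dual k P) (t : M ⊗[k] N) :
    contractLeft f (φ.rTensor N t) = contractLeft (f ∘ₗ φ) t := by
  induction t with
  | zero => simp
  | add x y hx hy => simp only [map_add, hx, hy]
  | tmul x y => simp

lemma contractLeft_assoc (f : Dual k M) (t : (M ⊗[k] N) ⊗[k] P) :
    contractLeft f (TensorProduct.assoc k M N P t) = (contractLeft f).rTensor P t := by
  induction t with
  | zero => simp
  | add x y hx hy => simp only [map_add, hx, hy]
  | tmul x y =>
    induction x with
    | zero => simp
    | add x y hx hy => simp only [map_add, add_tmul, hx, hy]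
    | tmul x z => simp [smul_tmul']

variable {H : Type*} [AddCommGroup H] [Module k H] [Coalgebra k H]

lemma comul_contractLeft_comul (f : Dual k H) (h : H) :
    comul (R := k) (contractLeft f (comul (R := k) h)) =
      (contractLeft f ∘ₗ comul).rTensor H (comul (R := k) h) := by
  rw [map_contractLeft, ← Coalgebra.coassoc_apply, contractLeft_assoc, LinearMap.rTensor_comp_apply]

lemma contractRight_comul_contractLeft (f g : Dual k H) (h : H) :
    contractRight f (comul (R := k) (contractLeft g (comul (R := k) h))) =
      contractLeft g (comul (R := k) (contractRight f (comul (R := k) h))) := by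
  rw [comul_contractLeft_comul, ← map_contractRight]
  rfl

lemma contractLeft_comul_contractLeft (f g : Dual k H) (h : H) :
    contractLeft f (comul (R := k) (contractLeft g (comul (R := k) h))) =
      contractLeft (f ∘ₗ contractLeft g ∘ₗ comul) (comul (R := k) h) := by
  rw [comul_contractLeft_comul, contractLeft_rTensor]

end Contract

variable {k H A : Type*} [Field k] [Ring H] [HopfAlgebra k H] [Ring A] [HopfAlgebra k A]

lemma contractLeft_repr {a : H} {ι : Type*} (r : Coalgebra.Repr k a ι) (f : Dual k H) :
    contractLeft f (comul (R := k) a) = ∑ i ∈ r.index, f (r.left i) • r.right i := by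
  rw [← r.eq]; simp

lemma contractRight_repr {a : H} {ι : Type*} (r : Coalgebra.Repr k a ι) (f : Dual k H) :
    contractRight f (comul (R := k) a) = ∑ i ∈ r.index, f (r.right i) • r.left i := by
  rw [← r.eq]; simp

/-- The algebra endomorphism `h ↦ ∑ χ(h₁) h₂` attached to a character `χ`. -/
def leftTranslate (χ : H →ₐ[k] k) : H →ₐ[k] H :=
  (Algebra.TensorProduct.lid k H).toAlgHom.comp
    ((Algebra.TensorProduct.map χ (AlgHom.id k H)).comp (Bialgebra.comulAlgHom k H))

lemma leftTranslate_apply (χ : H →ₐ[k] k) (h : H) :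
    leftTranslate χ h = contractLeft χ.toLinearMap (comul (R := k) h) := rfl

/-- Translation by χ ∘ S undoes translation by χ. -/
lemma leftTranslate_surjective (χ : H →ₐ[k] k) : Function.Surjective (leftTranslate χ) := by
  intro h
  refine ⟨contractLeft (χ.toLinearMap ∘ₗ antipode k) (comul (R := k) h), ?_⟩
  rw [leftTranslate_apply, contractLeft_comul_contractLeft]
  conv_rhs => rw [← contractLeft_counit_comul (k := k) h]
  congr 2
  ext a
  have := congr($(antipode_conv_algHom χ) a)
  rw [conv_apply_repr (ℛ k a)] at this
  simp only [LinearMap.comp_apply, contractLeft_repr (ℛ k a), map_sum, map_smul]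
  simpa using! this

section Adjoint

lemma leftAdjoint_repr {h : H} {ι : Type*} (r : Coalgebra.Repr k h ι) (a : H) :
    leftAdjoint k a h = ∑ i ∈ r.index, r.left i * a * antipode k (r.right i) := by
  rw [leftAdjoint, LinearMap.comp_apply, LinearMap.comp_apply, ← r.eq]
  simp

lemma rightAdjoint_repr {h : H} {ι : Type*} (r : Coalgebra.Repr k h ι) (a : H) :
    rightAdjoint k a h = ∑ i ∈ r.index, antipode k (r.left i) * a * r.right i := by
  rw [rightAdjoint, LinearMap.comp_apply, LinearMap.comp_apply, ← r.eq]
  simp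

lemma leftAdjoint_eq_conv (a : H) : toConv (leftAdjoint k a) =
    toConv (LinearMap.mulRight k a) * toConv (antipode k) := by
  ext h
  change leftAdjoint k a h = _
  rw [conv_apply_repr (ℛ k h), leftAdjoint_repr (ℛ k h)]
  rfl

/-- Read pointwise, ∑ (h₁ a S(h₂))h₃ = ha: this converts adjoint stability into a commutation rule.
-/
lemma leftAdjoint_conv_id (a : H) :
    toConv (leftAdjoint k a) * toConv LinearMap.id = toConv (LinearMap.mulRight k a) := by
  rw [leftAdjoint_eq_conv, mul_assoc, LinearMap.antipode_mul_id, mul_one]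

@[simp] lemma leftAdjoint_one (a : H) : leftAdjoint k a 1 = a := by
  simp [leftAdjoint, Algebra.TensorProduct.one_def]

lemma leftAdjoint_mul (a g h : H) :
    leftAdjoint k a (g * h) = leftAdjoint k (leftAdjoint k a h) g := by
  have key : ∀ s t : H ⊗[k] H, LinearMap.mul' k H (TensorProduct.map (LinearMap.mulRight k a)
      (antipode k) (s * t)) = LinearMap.mul' k H (TensorProduct.map (LinearMap.mulRight k
      (LinearMap.mul' k H (TensorProduct.map (LinearMap.mulRight k a) (antipode k) t)))
      (antipode k) s) := by
    intro s t
    induction s with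
    | zero => simp
    | add x y hx hy => simp only [map_add, add_mul, hx, hy]
    | tmul x y =>
      induction t with
      | zero => simp
      | add z w hz hw =>
        rw [mul_add, map_add, map_add, hz, hw]
        simp [mul_add, add_mul]
      | tmul z w => simp [antipode_mul_antidistrib, mul_assoc]
  have := key (comul (R := k) g) (comul h)
  rw [← Bialgebra.comul_mul] at this
  exact this

lemma counit_leftAdjoint (a h : H) :
    counit (R := k) (leftAdjoint k a h) = counit (R := k) h * counit (R := k) a := by
  rw [leftAdjoint_repr (ℛ k h)]
  simp only [map_sum, Bialgebra.counit_mul, counit_antipode]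
  conv_rhs => rw [← contractLeft_counit_comul (k := k) h, contractLeft_repr (ℛ k h), map_sum,
    Finset.sum_mul]
  refine Finset.sum_congr rfl fun i _ => ?_
  simp; ring

/-- The left adjoint action preserves coinvariants. -/
lemma leftAdjoint_mem_coinvariants (π : H →ₐc[k] A) {a : H} (ha : a ∈ coinvariants π) (h : H) :
    leftAdjoint k a h ∈ coinvariants π := by
  let Φ : H →ₐ[k] H ⊗[k] A :=
    (Algebra.TensorProduct.map (AlgHom.id k H) (π : H →ₐ[k] A)).comp (Bialgebra.comulAlgHom k H)
  let ι : H →ₐ[k] H ⊗[k] A := Algebra.TensorProduct.includeLeft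
  let κ : H →ₐ[k] H ⊗[k] A := Algebra.TensorProduct.includeRight.comp (π : H →ₐ[k] A)
  have hΦ : ∀ x {I : Type _} (r : Coalgebra.Repr k x I),
      Φ x = ∑ i ∈ r.index, ι (r.left i) * κ (r.right i) := by
    intro x I r
    change Algebra.TensorProduct.map _ _ (comul x) = _
    rw [← r.eq]
    simp [ι, κ]
  have hX : Φ a = ι a := ha
  let X := ι a
  have hc : ∀ x, Commute (κ x) X := by
    intro x
    simp [κ, X, ι, Commute, SemiconjBy]
  -- Φ is the convolution ι ∗ κ, and κ commutes with X = a ⊗ 1. So κ moves past X and cancels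
  -- against its inverse inside Φ ∘ S, leaving only ι.
  have h1 : toConv (LinearMap.mulRight k X ∘ₗ Φ.toLinearMap) =
      toConv (LinearMap.mulRight k X ∘ₗ ι.toLinearMap) * toConv κ.toLinearMap := by
    ext x
    change Φ x * X = _
    rw [conv_apply_repr (ℛ k x), hΦ x (ℛ k x), Finset.sum_mul]
    refine Finset.sum_congr rfl fun i _ => ?_
    simp [mul_assoc, (hc _).eq]
  have h2 : toConv Φ.toLinearMap = toConv ι.toLinearMap * toConv κ.toLinearMap := by
    ext x
    change Φ x = _
    rw [conv_apply_repr (ℛ k x), hΦ x (ℛ k x)]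
    rfl
  have h3 : toConv (LinearMap.mulRight k X ∘ₗ Φ.toLinearMap) * toConv (Φ.toLinearMap ∘ₗ antipode k)
      =
      toConv (LinearMap.mulRight k X ∘ₗ ι.toLinearMap) * toConv (ι.toLinearMap ∘ₗ antipode k) := by
    have : toConv (LinearMap.mulRight k X ∘ₗ Φ.toLinearMap) =
        toConv (LinearMap.mulRight k X ∘ₗ ι.toLinearMap) * toConv (ι.toLinearMap ∘ₗ antipode k) *
          toConv Φ.toLinearMap := by
      rw [h1, h2, mul_assoc, ← mul_assoc _ _ (toConv κ.toLinearMap), antipode_conv_algHom, one_mul]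
    rw [this, mul_assoc, algHom_conv_antipode, mul_one]
  have h4 := congr($h3 h)
  rw [conv_apply_repr (ℛ k h), conv_apply_repr (ℛ k h)] at h4
  change Φ (leftAdjoint k a h) = ι (leftAdjoint k a h)
  rw [leftAdjoint_repr (ℛ k h), map_sum, map_sum]
  simp only [map_mul, hX]
  exact h4

end Adjoint

end HopfAlgebra

/-! ### The central grouplike element behind the coinvariants. -/

namespace HopfAlgebra

open Coalgebra WithConv TensorProduct Module HopfSubalgebra HopfDual

variable {k H A : Type*} [Field k] [Ring H] [HopfAlgebra k H] [Ring A] [HopfAlgebra k A]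

/-- If the coinvariants of `π` have dimension two, their augmentation ideal is spanned by one
element. -/
lemma exists_generator_of_finrank_coinvariants (π : H →ₐc[k] A)
    (h2 : finrank k (coinvariants π) = 2) :
    ∃ x ∈ coinvariants π, x ≠ 0 ∧ counit (R := k) x = 0 ∧
      ∀ r ∈ coinvariants π, counit (R := k) r = 0 → ∃ c : k, r = c • x := by
  let ε : coinvariants π →ₗ[k] k := counit ∘ₗ (coinvariants π).val.toLinearMap
  have hfin : FiniteDimensional k (coinvariants π) := Module.finite_of_finrank_pos (by omega)
  have hs : Function.Surjective ε := fun c => ⟨c • 1, by simp [ε]⟩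
  have h1 : finrank k (LinearMap.ker ε) = 1 := by
    have := LinearMap.finrank_range_add_finrank_ker ε
    rw [LinearMap.range_eq_top.mpr hs, finrank_top, finrank_self] at this
    omega
  obtain ⟨⟨⟨x, hxR⟩, hx⟩, hx0, hspan⟩ := finrank_eq_one_iff'.mp h1
  refine ⟨x, hxR, fun h => hx0 (by ext; exact h), hx, fun r hr hr0 => ?_⟩
  obtain ⟨c, hc⟩ := hspan ⟨⟨r, hr⟩, hr0⟩
  exact ⟨c, congr((($hc).1 : H)).symm⟩

lemma coinvariants_map_eq [FiniteDimensional k A] (π : H →ₐc[k] A) {x : H}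
    (hx : x ∈ coinvariants π) : π x = counit (R := k) x • 1 := by
  rw [mem_coinvariants_iff] at hx
  rw [← sub_eq_zero]
  by_contra hne
  obtain ⟨b, hb⟩ := Module.Projective.exists_dual_ne_zero k hne
  apply hb
  have h1 := congr(counit (R := k) $(hx b))
  rw [← apply_contractLeft, contractLeft_counit_comul, map_smul] at h1
  have h2 : b (π x) = b 1 * counit (R := k) x := h1
  rw [map_sub, h2, map_smul, smul_eq_mul, mul_comm, sub_self]

/-- The coinvariants form a right coideal in the second tensor factor. -/
lemma contractLeft_mem_coinvariants [FiniteDimensional k A] (π : H →ₐc[k] A) {x : H}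
    (hx : x ∈ coinvariants π) (f : Dual k H) :
    contractLeft f (comul (R := k) x) ∈ coinvariants π := by
  rw [mem_coinvariants_iff] at hx ⊢
  intro b
  rw [contractRight_comul_contractLeft, hx b, map_smul, map_smul]

variable [FiniteDimensional k H]

/-- The hypothesis says Δ(x) ∈ x ⊗ 1 + H ⊗ x. Coassociativity makes the coefficient of x grouplike,
and the counit axiom normalizes it. -/
lemma exists_groupLike_of_skew (x : H) (hx0 : x ≠ 0) (hε : counit (R := k) x = 0)
    (h : ∀ f : Dual k H, ∃ c : k, contractLeft f (comul (R := k) x) = f x • 1 + c • x) :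
    ∃ g : H, IsGroupLikeElem k g ∧ comul (R := k) x = x ⊗ₜ 1 + g ⊗ₜ x := by
  obtain ⟨φ, hφ⟩ := Module.Projective.exists_dual_eq_one k hx0
  -- If Δ(x) = x ⊗ 1 + g ⊗ x and φ(x) = 1, contracting the second leg by φ gives φ(1)x + g.
  let g := contractRight φ (comul (R := k) x) - φ 1 • x
  have hΔ : comul (R := k) x = x ⊗ₜ 1 + g ⊗ₜ x := by
    refine tensor_ext_contractLeft fun f => ?_
    obtain ⟨c, hc⟩ := h f
    have : f g = c := by
      simp only [g, map_sub, ← apply_contractLeft, hc, map_add, map_smul, hφ, smul_eq_mul]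
      ring
    simp [hc, this]
  refine ⟨g, ⟨?_, ?_⟩, hΔ⟩
  · have h1 := contractLeft_counit_comul (k := k) x
    rw [hΔ] at h1
    simp only [map_add, contractLeft_tmul, hε, zero_smul, zero_add] at h1
    have h2 := congr(φ $h1)
    simpa [hφ] using h2
  · have h1 := Coalgebra.coassoc_apply (R := k) x
    simp only [hΔ, map_add, LinearMap.rTensor_tmul, LinearMap.lTensor_tmul, add_tmul, tmul_add,
      Bialgebra.comul_one, Algebra.TensorProduct.one_def, _root_.TensorProduct.assoc_tmul] at h1
    rw [add_assoc, add_right_inj, add_right_inj, ← _root_.TensorProduct.assoc_tmul] at h1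
    have h2 := congr(contractRight φ $((TensorProduct.assoc k H H H).injective h1))
    simpa [hφ] using h2

omit [FiniteDimensional k H] in
-- The line kx is stable under the adjoint action, so H acts on it through a character χ; then ax =
-- ∑ (a₁ x S(a₂))a₃ = x ∑ χ(a₁)a₂.
lemma exists_character_of_adjoint (x : H) (hx0 : x ≠ 0)
    (h : ∀ a : H, ∃ c : k, leftAdjoint k x a = c • x) :
    ∃ χ : H →ₐ[k] k, ∀ a, a * x = x * leftTranslate χ a := by
  obtain ⟨φ, hφ⟩ := Module.Projective.exists_dual_eq_one k hx0
  have hφ' : ∀ a, leftAdjoint k x a = φ (leftAdjoint k x a) • x := by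
    intro a
    obtain ⟨c, hc⟩ := h a
    simp [hc, hφ]
  have hsmul : ∀ (c : k) a, leftAdjoint k (c • x) a = c • leftAdjoint k x a := by
    intro c a
    rw [leftAdjoint_repr (ℛ k a), leftAdjoint_repr (ℛ k a), Finset.smul_sum]
    simp
  refine ⟨AlgHom.ofLinearMap (φ ∘ₗ leftAdjoint k x) (by simp [hφ]) fun a b => ?_, fun a => ?_⟩
  · rw [LinearMap.comp_apply, leftAdjoint_mul, hφ' b, hsmul, map_smul, smul_eq_mul, mul_comm]
    rfl
  · have h1 := congr($(leftAdjoint_conv_id (k := k) x) a)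
    rw [conv_apply_repr (ℛ k a)] at h1
    refine h1.symm.trans ?_
    rw [leftTranslate_apply, contractLeft_repr (ℛ k a), Finset.mul_sum]
    refine Finset.sum_congr rfl fun i _ => ?_
    rw [hφ', mul_smul_comm, smul_mul_assoc]
    rfl

/-- A nonzero element of an odd-dimensional space cannot have anticommuting injective
endomorphisms. -/
lemma not_anticommute_of_odd {W : Type*} [AddCommGroup W] [Module k W] [CharZero k]
    [FiniteDimensional k W] (hW : Odd (finrank k W)) (S T : End k W) (hS : Function.Injective S)
    (hT : Function.Injective T) (h : T * S = -(S * T)) : False := by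
  have hS' : LinearMap.det S ≠ 0 :=
    ((LinearEquiv.ofInjectiveEndo S hS).isUnit_det').ne_zero
  have hT' : LinearMap.det T ≠ 0 :=
    ((LinearEquiv.ofInjectiveEndo T hT).isUnit_det').ne_zero
  -- In odd dimension the sign survives in the determinant, so 2 det S det T = 0.
  have h1 := congr(LinearMap.det $h)
  rw [← neg_one_smul k (S * T), LinearMap.det_smul, map_mul, map_mul, hW.neg_one_pow,
    mul_comm, neg_one_mul, eq_neg_iff_add_eq_zero, ← two_mul] at h1
  simp [hS', hT'] at h1

variable [FiniteDimensional k A]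

/-- The functionals on `H` that vanish on the right ideal generated by `x`. -/
def rightIdealAnnihilator (x : H) : Submodule k (HopfDual k H) :=
  LinearMap.ker ((LinearMap.mulLeft k x).dualMap ∘ₗ (toDual k H).toLinearMap)

omit [FiniteDimensional k H] [FiniteDimensional k A] in
lemma mem_rightIdealAnnihilator {x : H} {f : HopfDual k H} :
    f ∈ rightIdealAnnihilator (k := k) x ↔ ∀ h, toDual k H f (x * h) = 0 := by
  rw [rightIdealAnnihilator, LinearMap.mem_ker]
  exact LinearMap.ext_iff

/-- A skew primitive element killed by a map onto a Hopf algebra of half the dimension generates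
a right ideal of half the dimension. -/
lemma finrank_range_mulLeft_of_skew (π : H →ₐc[k] A) (hπ : Function.Surjective π)
    (hdim : finrank k H = 2 * finrank k A) {x g : H} (hx0 : x ≠ 0) (hπx : π x = 0)
    (hε : counit (R := k) x = 0) (hΔ : comul (R := k) x = x ⊗ₜ 1 + g ⊗ₜ x) :
    finrank k (LinearMap.range (LinearMap.mulLeft k x)) = finrank k A := by
  set V := rightIdealAnnihilator (k := k) x with hV
  have hrank : finrank k V + finrank k (LinearMap.range (LinearMap.mulLeft k x)) =
      finrank k H := by
    have h1 := LinearMap.finrank_range_add_finrank_ker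
      ((LinearMap.mulLeft k x).dualMap ∘ₗ (toDual k H).toLinearMap)
    rw [LinearMap.range_comp_of_range_eq_top _ (LinearEquiv.range _),
      LinearMap.finrank_range_dualMap_eq_finrank_range, HopfDual.finrank_eq] at h1
    rw [← h1, add_comm]
    rfl
  -- In Δ(xh) = (x ⊗ 1 + g ⊗ x)Δ(h), the first term dies under π and the second under v.
  have hB : ∀ b, ∀ v ∈ V, HopfDual.map π b * v ∈ V := by
    intro b v hv
    rw [hV, mem_rightIdealAnnihilator] at hv ⊢
    intro h
    rw [toDual_map_mul, Bialgebra.comul_mul, hΔ, ← (ℛ k h).eq]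
    simp [Finset.mul_sum, add_mul, hπx, hv]
  have hcoid : ∀ v ∈ V, ∀ f, contractRight f (comul (R := k) v) ∈ V := by
    intro v hv F
    rw [hV, mem_rightIdealAnnihilator] at hv ⊢
    intro h
    obtain ⟨y, hy⟩ := exists_eval F
    rw [toDual_contractRight_comul F y hy, mul_assoc, hv]
  have h1 : (1 : HopfDual k H) ∈ V := by
    rw [hV, mem_rightIdealAnnihilator]
    intro h
    simp [hε]
  -- V is proper since x ≠ 0, so it lies in A*; conversely A* = A*·1 ⊆ V.
  have hlt : finrank k V < 2 * finrank k (HopfDual k A) := by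
    rw [HopfDual.finrank_eq, ← hdim]
    have : 0 < finrank k (LinearMap.range (LinearMap.mulLeft k x)) := by
      have : Nontrivial (LinearMap.range (LinearMap.mulLeft k x)) :=
        ⟨⟨x, 1, by simp⟩, 0, fun h => hx0 congr(($h).1)⟩
      exact finrank_pos
    omega
  have hj := HopfDual.map_injective π hπ
  have hsub := le_range_of_finrank_lt (HopfDual.map π) hj V hB hcoid h1 hlt
  have hVeq : V = LinearMap.range (HopfDual.map π : HopfDual k A →ₐ[k] HopfDual k H).toLinearMap :=
      by
    apply le_antisymm
    · intro v hv
      obtain ⟨b, rfl⟩ := hsub v hv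
      exact ⟨b, rfl⟩
    · rintro _ ⟨b, rfl⟩
      have := hB b 1 h1
      rwa [mul_one] at this
  have hVrank : finrank k V = finrank k A := by
    rw [hVeq, ← HopfDual.finrank_eq (k := k) (H := A)]
    exact LinearMap.finrank_range_of_inj
      (f := (HopfDual.map π : HopfDual k A →ₐ[k] HopfDual k H).toLinearMap) hj
  omega

/-- The coinvariants of a surjection between Hopf algebras of dimensions `2n` and `n`, with `n`
odd, are spanned by `1` and a central grouplike element of order two. -/
theorem exists_central_groupLike [CharZero k] (π : H →ₐc[k] A) (hπ : Function.Surjective π)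
    (hdim : finrank k H = 2 * finrank k A) (hodd : Odd (finrank k A)) :
    ∃ g : H, IsGroupLikeElem k g ∧ g ≠ 1 ∧ g * g = 1 ∧ (∀ h, g * h = h * g) ∧
      ∀ r, r ∈ coinvariants π ↔ ∃ a b : k, r = a • 1 + b • g := by
  obtain ⟨x, hxR, hx0, hε, hspan⟩ := exists_generator_of_finrank_coinvariants π
    (finrank_coinvariants π hπ hdim hodd.pos)
  have hspan' : ∀ r ∈ coinvariants π, ∃ c : k, r = counit (R := k) r • 1 + c • x := by
    intro r hr
    obtain ⟨c, hc⟩ := hspan (r - counit (R := k) r • 1)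
      (sub_mem hr (Subalgebra.smul_mem _ (one_mem _) _)) (by simp)
    exact ⟨c, by rw [← hc]; abel⟩
  have hπx : π x = 0 := by rw [coinvariants_map_eq π hxR, hε, zero_smul]
  obtain ⟨g, hg, hΔ⟩ := exists_groupLike_of_skew x hx0 hε fun f => by
    obtain ⟨c, hc⟩ := hspan' _ (contractLeft_mem_coinvariants π hxR f)
    refine ⟨c, hc.trans ?_⟩
    rw [apply_contractLeft, contractRight_counit_comul]
  obtain ⟨χ, hχ⟩ := exists_character_of_adjoint x hx0 fun a =>
    hspan _ (leftAdjoint_mem_coinvariants π hxR a) (by rw [counit_leftAdjoint, hε, mul_zero])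
  obtain ⟨α, hα⟩ := hspan (x * x) (mul_mem hxR hxR) (by simp [hε])
  have hTg : leftTranslate χ g = χ g • g := by
    simp [leftTranslate_apply, hg.comul_eq_tmul_self]
  have hTx : leftTranslate χ x = χ x • 1 + χ g • x := by
    simp [leftTranslate_apply, hΔ]
  have hgu : IsUnit g := hg.isUnit
  have hgx : g * x = χ g • (x * g) := by rw [hχ, hTg, mul_smul_comm]
  obtain ⟨φ, hφ⟩ := Module.Projective.exists_dual_eq_one k hx0
  -- Compare the coefficients of x in the second leg of Δ(x²) = αΔ(x), after replacing x² by αx.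
  have hcomm : x * g + g * x = α • (g - g * g) := by
    have h1 := congr(contractRight φ (comul (R := k) $hα))
    rw [Bialgebra.comul_mul, hΔ, map_smul, hΔ] at h1
    simp [mul_add, add_mul, hα, hφ] at h1
    linear_combination (norm := module) h1
  have hrel : (χ g + 1) • x = α • (1 - g) := by
    apply hgu.mul_right_cancel
    rw [hgx] at hcomm
    rw [smul_mul_assoc, add_smul, one_smul, add_comm, hcomm, smul_mul_assoc, sub_mul, one_mul]
  by_cases hχg : χ g + 1 = 0
  -- Here α = 0, as otherwise g = 1 and χ(g) = 1. So x² = 0, which forces χ(x) = 0 and T(x) = −x. On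
  -- xH, of odd dimension, T and left multiplication by g anticommute.
  · exfalso
    have hχg' : χ g = -1 := eq_neg_of_add_eq_zero_left hχg
    have hα0 : α = 0 := by
      by_contra hα0
      rw [hχg, zero_smul, eq_comm, smul_eq_zero_iff_right hα0, sub_eq_zero] at hrel
      rw [← hrel, map_one, one_add_one_eq_two] at hχg
      exact two_ne_zero hχg
    rw [hα0, zero_smul] at hα
    have hχx : χ x = 0 := by
      have h1 := hχ x
      rw [hTx, mul_add, mul_smul_comm, mul_smul_comm, hα, smul_zero, add_zero, mul_one,
        eq_comm, smul_eq_zero] at h1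
      exact h1.resolve_right hx0
    rw [hχx, hχg', zero_smul, zero_add, neg_one_smul] at hTx
    rw [hχg', neg_one_smul] at hTg hgx
    have hW := finrank_range_mulLeft_of_skew π hπ hdim hx0 hπx hε hΔ
    let W := LinearMap.range (LinearMap.mulLeft k x)
    have hWg : ∀ w ∈ W, LinearMap.mulLeft k g w ∈ W := by
      rintro _ ⟨h, rfl⟩
      refine ⟨-(g * h), ?_⟩
      simp [← mul_assoc, hgx]
    have hWT : ∀ w ∈ W, (leftTranslate χ).toLinearMap w ∈ W := by
      rintro _ ⟨h, rfl⟩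
      refine ⟨-(leftTranslate χ h), ?_⟩
      simp [hTx]
    refine not_anticommute_of_odd (W := W) (hW ▸ hodd) ((LinearMap.mulLeft k g).restrict hWg)
      ((leftTranslate χ).toLinearMap.restrict hWT) ?_ ?_ ?_
    · intro v w h
      exact Subtype.ext (hgu.mul_left_cancel congr(($h).1))
    · intro v w h
      have hinj : Function.Injective (leftTranslate χ).toLinearMap :=
        LinearMap.injective_iff_surjective.mpr (leftTranslate_surjective χ)
      exact Subtype.ext (hinj congr(($h).1))
    · ext w
      change leftTranslate χ (g * w) = -(g * leftTranslate χ w)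
      rw [map_mul, hTg, neg_mul]
  · have hg1 : g ≠ 1 := by
      rintro rfl
      rw [sub_self, smul_zero, smul_eq_zero] at hrel
      exact hrel.elim hχg hx0
    let c := (χ g + 1)⁻¹ * α
    have hxc : x = c • (1 - g) := by
      rw [mul_smul, ← hrel, smul_smul, inv_mul_cancel₀ hχg, one_smul]
    have hc : c ≠ 0 := fun h => hx0 (by rw [hxc, h, zero_smul])
    have hgR : g = 1 - c⁻¹ • x := by
      rw [hxc, smul_smul, inv_mul_cancel₀ hc]; simp
    have hgmem : g ∈ coinvariants π := by
      rw [hgR]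
      exact sub_mem (one_mem _) (Subalgebra.smul_mem _ hxR _)
    -- g² is a grouplike element in the span of 1 and g, hence 1 or g by independence of grouplikes;
    -- g² = g would give g = 1.
    have hgg : g * g = 1 := by
      obtain ⟨d, hd⟩ := hspan' (g * g) (mul_mem hgmem hgmem)
      simp only [Bialgebra.counit_mul, hg.counit_eq_one, mul_one, one_smul] at hd
      have hd' : g * g = (1 + d * c) • 1 - (d * c) • g := by
        rw [hd, hxc, smul_smul, smul_sub, add_smul, one_smul]; abel
      -- This functional kills 1 and sends g to −c⁻¹, which isolates the relation d(1 + dc)(1 − g) =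
      -- 0.
      have h1 := congr(contractLeft (φ - φ 1 • counit) (comul (R := k) $hd'))
      have hφg : φ g = φ 1 - c⁻¹ := by rw [hgR]; simp [hφ]
      rw [(hg.mul hg).comul_eq_tmul_self] at h1
      simp only [map_sub, map_smul, Bialgebra.comul_one, Algebra.TensorProduct.one_def,
        hg.comul_eq_tmul_self, contractLeft_tmul, LinearMap.sub_apply, LinearMap.smul_apply,
        Bialgebra.counit_one, hg.counit_eq_one, hφg, hd'] at h1
      have e : d * c * c⁻¹ = d := by rw [mul_assoc, mul_inv_cancel₀ hc, mul_one]
      have e1 : φ 1 - c⁻¹ - φ 1 = -c⁻¹ := by ring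
      simp only [smul_eq_mul, mul_one, sub_self, mul_zero, zero_smul, e1, mul_neg, e, zero_sub,
        neg_neg, smul_zero, smul_smul, ← neg_smul] at h1
      have h2 : (d * (1 + d * c)) • (1 - g) = 0 := by linear_combination (norm := module) h1
      rcases mul_eq_zero.mp ((smul_eq_zero.mp h2).resolve_right (sub_ne_zero.mpr hg1.symm))
        with h3 | h3
      · rw [hd, h3, zero_smul, add_zero]
      · have h4 : d * c = -1 := by linear_combination h3
        rw [h4] at hd'
        have h5 : g * g = g * 1 := by rw [hd', mul_one]; simp
        exact absurd (hgu.mul_left_cancel h5) hg1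
    have hx2 : x * x = (2 * c) • x := by
      rw [hxc]
      simp [sub_mul, mul_sub, hgg, smul_smul]
      module
    -- Two passes through x give hx² = x²T²(h), and x² = 2cx reduces this to hx = xT²(h) = T(h)x.
    -- Since also hx = xT(h), x commutes with the image of T, which is all of H.
    have hcentral : ∀ h, h * x = x * h := by
      intro h
      obtain ⟨h, rfl⟩ := leftTranslate_surjective χ h
      have h1 := hχ h
      have h2 : h * (x * x) = x * x * leftTranslate χ (leftTranslate χ h) := by
        rw [← mul_assoc, h1, mul_assoc, hχ (leftTranslate χ h), mul_assoc]
      rw [hx2, mul_smul_comm, smul_mul_assoc, h1] at h2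
      rw [hχ (leftTranslate χ h)]
      exact (smul_right_injective H (mul_ne_zero two_ne_zero hc) h2).symm
    refine ⟨g, hg, hg1, hgg, fun h => ?_, fun r => ⟨fun hr => ?_, ?_⟩⟩
    · rw [hgR, sub_mul, mul_sub, one_mul, mul_one, smul_mul_assoc, mul_smul_comm, hcentral]
    · obtain ⟨d, hd⟩ := hspan' r hr
      refine ⟨counit (R := k) r + d * c, -(d * c), hd.trans ?_⟩
      rw [hxc, smul_smul, smul_sub, add_smul, neg_smul]; abel
    · rintro ⟨a, b, rfl⟩
      exact add_mem (Subalgebra.smul_mem _ (one_mem _) _) (Subalgebra.smul_mem _ hgmem _)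

end HopfAlgebra

/-! ### Normality of Hopf subalgebras of half the dimension. -/

namespace HopfSubalgebra

open Coalgebra WithConv TensorProduct Module HopfAlgebra

variable {k H : Type*} [Field k] [Ring H] [HopfAlgebra k H]

/-- The inclusion of a Hopf subalgebra. -/
def inclusion (K : HopfSubalgebra k H) : K.toSubalgebra →ₐc[k] H :=
  BialgHom.ofAlgHom K.toSubalgebra.val rfl (by ext a; exact K.incl₂_comulHom a)

lemma leftTranslate_of_mem (K : HopfSubalgebra k H) (σ : H →ₐ[k] k)
    (hσ : ∀ a ∈ K.toSubalgebra, σ a = counit (R := k) a) {a : H} (ha : a ∈ K.toSubalgebra) :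
    leftTranslate σ a = a := by
  conv_rhs => rw [← contractLeft_counit_comul (k := k) a]
  rw [leftTranslate_apply]
  obtain ⟨t, ht⟩ := K.comul_mem a ha
  have key : ∀ t : K.toSubalgebra ⊗[k] K.toSubalgebra,
      contractLeft σ.toLinearMap (K.incl₂ t) = contractLeft counit (K.incl₂ t) := by
    intro t
    induction t with
    | zero => simp
    | add x y hx hy => simp only [map_add, hx, hy]
    | tmul x y => simp [hσ]
  rw [← ht]
  exact key t

section Central

variable {σ : H →ₐ[k] k}

lemma leftTranslate_eq_conv (σ : H →ₐ[k] k) : toConv (leftTranslate σ).toLinearMap =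
    toConv ((Algebra.ofId k H).comp σ).toLinearMap * toConv LinearMap.id := by
  ext a
  change leftTranslate σ a = _
  rw [leftTranslate_apply, contractLeft_repr (ℛ k a), conv_apply_repr (ℛ k a)]
  simp [Algebra.ofId_apply, Algebra.smul_def]

lemma leftTranslate_eq_id_conv (hσ : ∀ h, contractLeft σ.toLinearMap (comul (R := k) h) =
    contractRight σ.toLinearMap (comul (R := k) h)) : toConv (leftTranslate σ).toLinearMap =
    toConv LinearMap.id * toConv ((Algebra.ofId k H).comp σ).toLinearMap := by
  ext a
  change leftTranslate σ a = _
  rw [leftTranslate_apply, hσ, contractRight_repr (ℛ k a), conv_apply_repr (ℛ k a)]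
  simp [Algebra.ofId_apply, Algebra.smul_def, Algebra.commutes]

/-- Centrality of σ lets the translation T be written as id ∗ σ as well. Convolving ∑ h₁ a S(h₂)
with T then gives T(h)a, whence ∑ h₁ a S(h₂) = ∑ T(h₁) a T(S(h₂)), and T fixes the sum when it fixes
a. -/
lemma leftTranslate_leftAdjoint (hσ : ∀ h, contractLeft σ.toLinearMap (comul (R := k) h) =
    contractRight σ.toLinearMap (comul (R := k) h)) {a : H} (ha : leftTranslate σ a = a) (h : H) :
    leftTranslate σ (leftAdjoint k a h) = leftAdjoint k a h := by
  set T := leftTranslate σ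
  have h1 : toConv (leftAdjoint k a) * toConv T.toLinearMap =
      toConv (LinearMap.mulRight k a ∘ₗ T.toLinearMap) := by
    rw [leftTranslate_eq_id_conv hσ, ← mul_assoc, leftAdjoint_conv_id]
    ext x
    change _ = T x * a
    have hx : T x = _ := congr($(leftTranslate_eq_id_conv hσ) x)
    rw [hx, conv_apply_repr (ℛ k x), conv_apply_repr (ℛ k x), Finset.sum_mul]
    refine Finset.sum_congr rfl fun i _ => ?_
    simp [Algebra.ofId_apply, Algebra.commutes, mul_assoc]
  have h2 : toConv (leftAdjoint k a) = toConv (LinearMap.mulRight k a ∘ₗ T.toLinearMap) *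
      toConv (T.toLinearMap ∘ₗ antipode k) := by
    rw [← h1, mul_assoc, algHom_conv_antipode, mul_one]
  have h3 : leftAdjoint k a h = _ := congr($h2 h)
  conv_rhs => rw [h3, conv_apply_repr (ℛ k h)]
  rw [leftAdjoint_repr (ℛ k h), map_sum]
  simp [ha]

/-- Here T = σ ∗ id already has σ on the outer side: T convolved with ∑ S(h₁) a h₂ is aT(h), so the
sum equals ∑ T(S(h₁)) a T(h₂). -/
lemma leftTranslate_rightAdjoint {a : H} (ha : leftTranslate σ a = a) (h : H) :
    leftTranslate σ (rightAdjoint k a h) = rightAdjoint k a h := by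
  set T := leftTranslate σ
  have h0 : toConv (rightAdjoint k a) = toConv (antipode k) * toConv (LinearMap.mulLeft k a) := by
    ext x
    change rightAdjoint k a x = _
    rw [conv_apply_repr (ℛ k x), rightAdjoint_repr (ℛ k x)]
    simp [mul_assoc]
  have h1 : toConv T.toLinearMap * toConv (rightAdjoint k a) =
      toConv (LinearMap.mulLeft k a ∘ₗ T.toLinearMap) := by
    rw [leftTranslate_eq_conv σ, h0, mul_assoc, ← mul_assoc (toConv LinearMap.id),
      LinearMap.id_mul_antipode, one_mul]
    ext x
    change _ = a * T x
    have hx : T x = _ := congr($(leftTranslate_eq_conv σ) x)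
    rw [hx, conv_apply_repr (ℛ k x), conv_apply_repr (ℛ k x), Finset.mul_sum]
    refine Finset.sum_congr rfl fun i _ => ?_
    simp [Algebra.ofId_apply, ← Algebra.smul_def]
  have h2 : toConv (rightAdjoint k a) = toConv (T.toLinearMap ∘ₗ antipode k) *
      toConv (LinearMap.mulLeft k a ∘ₗ T.toLinearMap) := by
    rw [← h1, ← mul_assoc, antipode_conv_algHom, one_mul]
  have h3 : rightAdjoint k a h = _ := congr($h2 h)
  conv_rhs => rw [h3, conv_apply_repr (ℛ k h)]
  rw [rightAdjoint_repr (ℛ k h), map_sum]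
  simp [ha, mul_assoc]

end Central

/-- A Hopf subalgebra of odd dimension `n` in a Hopf algebra of dimension `2n` is normal. -/
theorem isNormal_of_finrank_eq [CharZero k] [FiniteDimensional k H] (K : HopfSubalgebra k H)
    (hdim : finrank k H = 2 * finrank k K.toSubalgebra)
    (hodd : Odd (finrank k K.toSubalgebra)) : K.IsNormal := by
  obtain ⟨g, hg, hg1, -, hcomm, hspan⟩ := exists_central_groupLike (HopfDual.map K.inclusion)
    (HopfDual.map_surjective _ Subtype.val_injective)
    (by rw [HopfDual.finrank_eq, HopfDual.finrank_eq, hdim])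
    (by rwa [HopfDual.finrank_eq])
  -- A grouplike element of H* is a character of H. Being a coinvariant of the restriction to K*, it
  -- restricts to ε on K.
  let σ : H →ₐ[k] k := AlgHom.ofLinearMap (HopfDual.toDual k H g) hg.counit_eq_one fun x y => by
    rw [← HopfDual.evalEquiv₂_comul, hg.comul_eq_tmul_self, HopfDual.evalEquiv₂_tmul]
  have hσK : ∀ a ∈ K.toSubalgebra, σ a = counit (R := k) a := by
    intro a ha
    have h1 := coinvariants_map_eq (HopfDual.map K.inclusion) ((hspan g).mpr ⟨0, 1, by simp⟩)
    rw [hg.counit_eq_one, one_smul] at h1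
    exact congr(HopfDual.toDual k _ $h1 ⟨a, ha⟩)
  have hσ : ∀ h, contractLeft σ.toLinearMap (comul (R := k) h) =
      contractRight σ.toLinearMap (comul (R := k) h) := by
    intro h
    rw [← sub_eq_zero]
    by_contra hne
    obtain ⟨φ, hφ⟩ := Module.Projective.exists_dual_ne_zero k hne
    apply hφ
    have h1 := congr(HopfDual.toDual k H $(hcomm ((HopfDual.toDual k H).symm φ)) h)
    rw [HopfDual.mul_apply_repr (ℛ k h), HopfDual.mul_apply_repr (ℛ k h)] at h1
    rw [map_sub, sub_eq_zero, contractLeft_repr (ℛ k h), contractRight_repr (ℛ k h)]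
    simpa [mul_comm] using! h1
  -- The fixed points of T form a right coideal that contains K and is stable under it. They are
  -- proper because σ ≠ ε, so their dimension is below 2 dim K and they lie in K.
  let V : Submodule k H := LinearMap.eqLocus (leftTranslate σ).toLinearMap LinearMap.id
  have hKV : ∀ a ∈ K.toSubalgebra, leftTranslate σ a = a := fun a =>
    K.leftTranslate_of_mem σ hσK
  have hVK : ∀ v, leftTranslate σ v = v → v ∈ K.toSubalgebra := by
    intro v hv
    have hsub := le_range_of_finrank_lt K.inclusion Subtype.val_injective V ?_ ?_
      (map_one (leftTranslate σ)) ?_ v hv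
    · obtain ⟨b, rfl⟩ := hsub
      exact b.2
    · intro b v hv
      exact (map_mul (leftTranslate σ) _ _).trans (congrArg₂ _ (hKV b b.2) hv)
    · intro v hv f
      change leftTranslate σ _ = _
      rw [leftTranslate_apply, ← contractRight_comul_contractLeft, ← leftTranslate_apply,
        show leftTranslate σ v = v from hv]
      rfl
    · rw [← hdim]
      refine Submodule.finrank_lt fun htop => hg1 ?_
      ext h
      have h1 : leftTranslate σ h = h := by
        have : h ∈ V := htop ▸ Submodule.mem_top
        exact this
      have h2 := congr(counit (R := k) $h1)
      rw [leftTranslate_apply, apply_contractLeft, contractRight_counit_comul] at h2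
      exact h2
  exact fun h a ha => ⟨hVK _ (leftTranslate_leftAdjoint hσ (hKV a ha) h),
    hVK _ (leftTranslate_rightAdjoint (hKV a ha) h)⟩

/-! ### The group algebra of order two spanned by a central involution. -/

section Cyclic

/-- The monoid homomorphism from the cyclic group of order two given by an involution. -/
def involutionHom {M : Type*} [Monoid M] (g : M) (hg : g * g = 1) :
    Multiplicative (ZMod 2) →* M where
  toFun m := if m = 1 then 1 else g
  map_one' := if_pos rfl
  map_mul' m n := by
    have : ∀ m : Multiplicative (ZMod 2), m = 1 ∨ m = Multiplicative.ofAdd 1 := by decide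
    have h1 : (Multiplicative.ofAdd 1 : Multiplicative (ZMod 2)) ≠ 1 := by decide
    have h2 : (Multiplicative.ofAdd 1 * Multiplicative.ofAdd 1 : Multiplicative (ZMod 2)) = 1 := by
      decide
    rcases this m with rfl | rfl <;> rcases this n with rfl | rfl <;> simp [h1, h2, hg]

lemma involutionHom_eq_or {M : Type*} [Monoid M] (g : M) (hg : g * g = 1)
    (m : Multiplicative (ZMod 2)) : involutionHom g hg m = 1 ∨ involutionHom g hg m = g :=
  ite_eq_or_eq _ _ _

lemma involutionHom_ofAdd_one {M : Type*} [Monoid M] (g : M) (hg : g * g = 1) :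
    involutionHom g hg (Multiplicative.ofAdd 1) = g := by
  have h : (Multiplicative.ofAdd 1 : Multiplicative (ZMod 2)) ≠ 1 := by decide
  simp [involutionHom, h]

/-- A two-dimensional subalgebra spanned by `1` and a central grouplike involution is a normal
Hopf subalgebra isomorphic to the group algebra of the cyclic group of order two. -/
theorem exists_of_central_groupLike {R : Subalgebra k H} (h2 : finrank k R = 2) {g : H}
    (hg : IsGroupLikeElem k g) (hgg : g * g = 1) (hcomm : ∀ h, g * h = h * g)
    (hR : ∀ r, r ∈ R ↔ ∃ a b : k, r = a • 1 + b • g) :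
    ∃ K : HopfSubalgebra k H, K.toSubalgebra = R ∧ K.IsNormal ∧
      Nonempty (K.toSubalgebra ≃ₐc[k] MonoidAlgebra k (Multiplicative (ZMod 2))) := by
  have hgR : g ∈ R := (hR g).mpr ⟨0, 1, by simp⟩
  have hS : antipode k g = g := left_inv_eq_right_inv hg.antipode_mul_cancel hgg
  obtain ⟨K, rfl⟩ : ∃ K : HopfSubalgebra k H, K.toSubalgebra = R := ⟨
    { R with
      comul_mem := by
        intro r hr
        obtain ⟨a, b, rfl⟩ := (hR r).mp hr
        refine ⟨a • (1 ⊗ₜ 1) + b • (⟨g, hgR⟩ ⊗ₜ ⟨g, hgR⟩), ?_⟩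
        simp [hg.comul_eq_tmul_self, Algebra.TensorProduct.one_def]
      antipode_mem := by
        intro r hr
        obtain ⟨a, b, rfl⟩ := (hR r).mp hr
        rw [map_add, map_smul, map_smul, hS, antipode_one]
        exact hr }, rfl⟩
  refine ⟨K, rfl, fun h r hr => ?_, ?_⟩
  · have hcr : ∀ y, r * y = y * r := by
      intro y
      obtain ⟨a, b, rfl⟩ := (hR r).mp hr
      simp [add_mul, mul_add, hcomm]
    constructor
    -- On a central element both adjoint actions reduce to the counit.
    · have : leftAdjoint k r h = counit (R := k) h • r := by
        rw [leftAdjoint_repr (ℛ k h)]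
        simp_rw [mul_assoc, hcr, ← mul_assoc]
        rw [← Finset.sum_mul, sum_mul_antipode_eq_smul, smul_one_mul]
      rw [this]
      exact Subalgebra.smul_mem _ hr _
    · have : rightAdjoint k r h = counit (R := k) h • r := by
        rw [rightAdjoint_repr (ℛ k h)]
        simp_rw [mul_assoc, hcr, ← mul_assoc]
        rw [← Finset.sum_mul, sum_antipode_mul_eq_smul, smul_one_mul]
      rw [this]
      exact Subalgebra.smul_mem _ hr _
  · let g' : K.toSubalgebra := ⟨g, hgR⟩
    have hg' : IsGroupLikeElem k g' :=
      ⟨hg.counit_eq_one, K.incl₂_injective ((K.incl₂_comulHom g').trans hg.comul_eq_tmul_self)⟩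
    let u := involutionHom g' (Subtype.ext hgg)
    have hu : ∀ m, IsGroupLikeElem k (u m) := fun m =>
      (involutionHom_eq_or g' (Subtype.ext hgg) m).elim (fun h => h ▸ .one) fun h => h ▸ hg'
    let φ : MonoidAlgebra k (Multiplicative (ZMod 2)) →ₐc[k] K.toSubalgebra :=
      BialgHom.ofAlgHom (MonoidAlgebra.lift k _ _ u)
        (by ext m; simp [(hu _).counit_eq_one])
        (by ext m; simp [(hu _).comul_eq_tmul_self])
    have hφ : ∀ m, φ (MonoidAlgebra.single m 1) = u m := fun m => by simp [φ]
    have hs : Function.Surjective φ := by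
      rintro ⟨r, hr⟩
      obtain ⟨a, b, rfl⟩ := (hR r).mp hr
      refine ⟨a • 1 + b • MonoidAlgebra.single (Multiplicative.ofAdd 1) 1, ?_⟩
      rw [map_add, map_smul, map_smul, map_one, hφ, involutionHom_ofAdd_one]
      rfl
    have hfin : FiniteDimensional k K.toSubalgebra := Module.finite_of_finrank_pos (by
      omega)
    have hi : Function.Injective φ :=
      (LinearMap.injective_iff_surjective_of_finrank_eq_finrank
        (f := (φ : MonoidAlgebra k (Multiplicative (ZMod 2)) →ₐ[k] K.toSubalgebra).toLinearMap) (by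
          rw [h2]
          exact (MonoidAlgebra.coeffLinearEquiv k).finrank_eq.trans
            (Module.finrank_finsupp_self k (ι := Multiplicative (ZMod 2))))).mpr hs
    exact ⟨(BialgEquiv.ofBijective φ ⟨hi, hs⟩).symm⟩

end Cyclic

end HopfSubalgebra

end

theorem proposition1p3 {k : Type*} [Field k] [IsAlgClosed k] [CharZero k]
    {H : Type*} [Ring H] [HopfAlgebra k H] [FiniteDimensional k H]
    (n : ℕ) (hn : Odd n) (hH : Module.finrank k H = 2 * n) :
    (∀ {A : Type*} [Ring A] [HopfAlgebra k A] [FiniteDimensional k A],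
      Module.finrank k A = n → ∀ π : H →ₐc[k] A, Function.Surjective π →
        ∃ R : HopfSubalgebra k H, R.toSubalgebra = coinvariants π ∧ R.IsNormal ∧
          Nonempty (R.toSubalgebra ≃ₐc[k] MonoidAlgebra k (Multiplicative (ZMod 2)))) ∧
    (∀ A : HopfSubalgebra k H, Module.finrank k A.toSubalgebra = n → A.IsNormal) := by
  refine ⟨fun {A} _ _ _ hA π hπ => ?_, fun K hK => ?_⟩
  · subst hA
    obtain ⟨g, hg, -, hgg, hcomm, hspan⟩ := HopfAlgebra.exists_central_groupLike π hπ hH hn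
    exact HopfSubalgebra.exists_of_central_groupLike
      (HopfAlgebra.finrank_coinvariants π hπ hH hn.pos) hg hgg hcomm hspan
  · subst hK
    exact K.isNormal_of_finrank_eq hH hn
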